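/- Let $k\ge 0$ be an integer. Let $\mathcal C_k$ be the set of sequences $\mathbf a=(a_i)_{i\ge 0}$ of non-negative integers such that $a_i=0$ for all but finitely many $i$ and $a_i+a_{i+1}+a_{i+2}\le k$ for all $i\ge 0$. For $1\le l,l'\le k$ put $$A_{l,l'}=2\min(l,l')+\max(l+l'-k,0),$$ and for $\mathbf m=(m_1,\dots,m_k)\in\mathbb Z_{\ge 0}^k$ put $$Q(\mathbf m)=\frac12\sum_{l,l'=1}^k A_{l,l'}m_l m_{l'}-\frac12\sum_{l=1}^k A_{l,l}m_l ,$$ which is a non-negative integer. Let $(q)_n=\prod_{i=1}^n(1-q^i)$. Then, in the ring $\mathbb Z[[q]]$ of formal power series, $$\sum_{\mathbf a\in\mathcal C_k}q^{\sum_{i\ge 0} i a_i}=\sum_{m_1,\dots,m_k=0}^{\infty}\frac{q^{Q(\mathbf m)}}{\prod_{l=1}^k (q)_{m_l}},$$ where both sums converge: each power of $q$ occurs with a non-zero coefficient in only finitely many summands. -/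

import Mathlib

open scoped PowerSeries PowerSeries.WithPiTopology

namespace FermionicFormula

/-- The configurations `(a_0, a_1, a_2, …)`: finitely supported sequences of non-negative
integers such that `a_i + a_{i+1} + a_{i+2} ≤ k` for all `i ≥ 0`. -/
def configurations (k : ℕ) : Set (ℕ →₀ ℕ) :=
  {a | ∀ i, a i + a (i + 1) + a (i + 2) ≤ k}

/-- The degree `d(a) = ∑_i i a_i` of a configuration. -/
def degree (a : ℕ →₀ ℕ) : ℕ :=
  a.sum fun i n => i * n

/-- The `k × k` matrix `A_{l,l'} = 2 min(l,l') + max(l+l'-k, 0)`, `1 ≤ l, l' ≤ k`.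
The index `i : Fin k` stands for the weight `l = i + 1`, and the truncated subtraction of
natural numbers is the positive part `max(l+l'-k, 0)`. -/
def A (k : ℕ) : Matrix (Fin k) (Fin k) ℕ :=
  Matrix.of fun i j =>
    2 * min ((i : ℕ) + 1) ((j : ℕ) + 1) + (((i : ℕ) + 1) + ((j : ℕ) + 1) - k)

/-- `Q(m) = ½ (A m, m) - ½ ∑_l A_{l,l} m_l`. This is a non-negative integer, and neither the
subtraction nor the division truncates: see `Q_eq`. -/
def Q (k : ℕ) (m : Fin k → ℕ) : ℕ :=
  (((A k).mulVec m) ⬝ᵥ m - ∑ l, A k l l * m l) / 2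

theorem A_symm (k : ℕ) (i j : Fin k) : A k i j = A k j i := by
  simp only [A, Matrix.of_apply]
  rw [min_comm, add_comm ((i : ℕ) + 1)]

theorem sum_le_form (k : ℕ) (m : Fin k → ℕ) :
    ∑ l, A k l l * m l ≤ ((A k).mulVec m) ⬝ᵥ m := by
  simp only [dotProduct, Matrix.mulVec]
  refine Finset.sum_le_sum fun l _ => ?_
  have h : A k l l * m l ≤ ∑ j, A k l j * m j :=
    Finset.single_le_sum (f := fun j => A k l j * m j) (fun _ _ => Nat.zero_le _)
      (Finset.mem_univ l)
  rcases Nat.eq_zero_or_pos (m l) with h0 | h0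
  · simp [h0]
  · exact h.trans (Nat.le_mul_of_pos_right _ h0)

theorem form_modEq (k : ℕ) (m : Fin k → ℕ) :
    ((((A k).mulVec m) ⬝ᵥ m : ℕ) : ZMod 2) = ((∑ l, A k l l * m l : ℕ) : ZMod 2) := by
  have hsq : ∀ x : ZMod 2, x * x = x := by decide
  have hdbl : ∀ x : ZMod 2, x + x = 0 := by decide
  simp only [dotProduct, Matrix.mulVec, Finset.sum_mul]
  push_cast
  rw [← Finset.sum_product', ← sub_eq_zero]
  have hdiag : ∑ l : Fin k, (A k l l : ZMod 2) * (m l : ZMod 2)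
      = ∑ p : Fin k × Fin k,
          if p.1 = p.2 then (A k p.1 p.2 : ZMod 2) * m p.2 * m p.1 else 0 := by
    rw [Fintype.sum_prod_type]
    simp [mul_assoc, hsq]
  rw [hdiag, Finset.univ_product_univ, ← Finset.sum_sub_distrib]
  refine Finset.sum_involution (fun p _ => p.swap) ?_ ?_ ?_ ?_
  · rintro ⟨i, j⟩ -
    by_cases hij : i = j
    · simp [hij]
    · have hji : ¬ j = i := fun h => hij h.symm
      simp only [Prod.swap, hij, hji, if_false, sub_zero]
      rw [A_symm k j i, mul_right_comm]
      exact hdbl _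
  · rintro ⟨i, j⟩ - hne heq
    apply hne
    have : j = i := congrArg Prod.fst heq
    simp [this]
  · intros; exact Finset.mem_univ _
  · intros; simp

/-- The value of `Q` as a rational number. -/
theorem Q_eq (k : ℕ) (m : Fin k → ℕ) :
    (Q k m : ℚ) = 1 / 2 * ((((A k).mulVec m) ⬝ᵥ m : ℕ) : ℚ)
      - 1 / 2 * ((∑ l, A k l l * m l : ℕ) : ℚ) := by
  have hle := sum_le_form k m
  have hdvd : 2 ∣ ((A k).mulVec m) ⬝ᵥ m - ∑ l, A k l l * m l := by
    rw [← ZMod.natCast_eq_zero_iff, Nat.cast_sub hle, form_modEq, sub_self]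
  rw [Q, Nat.cast_div hdvd (by norm_num), Nat.cast_sub hle]
  push_cast
  ring

/-- `(q)_n = (1 - q)(1 - q^2) ⋯ (1 - q^n)`, as a formal power series in `q`. -/
noncomputable def qPoch (n : ℕ) : ℤ⟦X⟧ :=
  ∏ i ∈ Finset.range n, (1 - PowerSeries.X ^ (i + 1))

/-- The inverse `1 / (q)_n` in the ring of formal power series in `q`. -/
noncomputable def qPochInv (n : ℕ) : ℤ⟦X⟧ :=
  PowerSeries.invOfUnit (qPoch n) 1

theorem qPoch_mul_qPochInv (n : ℕ) : qPoch n * qPochInv n = 1 := by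
  apply PowerSeries.mul_invOfUnit
  simp [qPoch, map_prod]

end FermionicFormula

/-! The identity is refined by the number n of particles: configurations with `∑ a_i = n` correspond
to the m with `∑ l m_l = n`.

On the combinatorial side, bound `a_0 ≤ s` and `a_0 + a_1 ≤ t`. Splitting off the configurations
with `a_0 = s + 1` and deleting that entry gives `configSeries_zero` and `configSeries_succ`. With
the value 1 at n = 0, this recursion has only one solution (`recursion_unique`), because `1 - q^n`
is not a zero divisor for n > 0.

On the fermionic side, let N be the conjugate of the partition with m_l parts l. The summand becomes
a weight in N, namely a power of q times `∏ 1/(q)_{N_p - N_{p+1}}`, where the exponent couples p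
only with itself and with k + 1 - p (`weightExp_conjugate`). Put `U_p = q^{N_p}`, with `U_0 = 0`,
and let the bracket be the weighted sum over all integer sequences N of sum n. The solution of the
recursion is then `∑_{i ≤ s}` of the bracket of `U_{i+1}⋯U_k · U_{t+1}⋯U_k · (1 - U_i/U_{t+1})`.

The recursion for these brackets comes from `bracket_certSum`. Translating N by the indicator of an
a-element subset of {1, …, k} changes the weight by an explicit monomial in the U_p and by factors
`1 - U_p/U_{p+1}`. A suitable combination of these translations over all such subsets
(`cert_certSum`) equates two brackets. Both combinations are built by peeling off the outermost pair
of positions, and the second is the first with U reversed and inverted, up to the cube of the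
product of the U_p. Hence one closed form (`certSum_eq_certVal`) evaluates both. -/

namespace FermionicFormula

/-! ### Evaluation in closed form of the weighted sum over subsets. -/

section Certificate

variable {K : Type*} [Field K]

/-- One step of the recursion `certSum`, through the outermost pair of positions. -/
noncomputable def certStep (u : ℕ → K) (F : ℕ → ℕ → ℕ → ℕ → Bool → K → ℕ → K)
    (a b c d : ℕ) (l : Bool) (β : K) (x : ℕ) : K :=
  if b = 0 ∧ c = 0 ∧ d = 0 then 1 - u (x + (a + b + c + d) + 1) * β else
    (if l then 1 - u x * (u (x + 1))⁻¹ else 1) *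
        (if 0 < b ∧ 0 < c then u (x + 1) * u (x + (a + b + c + d) + 1) ^ 2 *
          F a (b - 1) (c - 1) (d + 1) false (u (x + (a + b + c + d) + 1))⁻¹ (x + 1) else 0)
      + (if 0 < c then u (x + (a + b + c + d) + 1) ^ 2 *
          F a b (c - 1) d true (u (x + (a + b + c + d) + 1))⁻¹ (x + 1) else 0)
      + (if l then 1 - u x * (u (x + 1))⁻¹ else 1) *
        (1 - u (x + (a + b + c + d) + 1) * β) *
        (if 0 < b then u (x + (a + b + c + d) + 1) *
          F a (b - 1) c d false 0 (x + 1) else 0)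
      + (1 - u (x + (a + b + c + d) + 1) * β) *
        (if 0 < d then u (x + (a + b + c + d) + 1) * (u (x + 1))⁻¹ *
          F a b c (d - 1) true 0 (x + 1) else 0)

/-- The starting values of `certSum`. -/
noncomputable def certBase (u : ℕ → K) (b c : ℕ) (l : Bool) (β : K) (x : ℕ) : K :=
  (∏ p ∈ Finset.Ico (x + 1) (x + b + c + 1), u p) *
    (∏ p ∈ Finset.Ico (x + b + 1) (x + b + c + 1), u p) *
    (if l then (1 - u x * (if b = 0 ∧ c = 0 then β else (u (x + 1))⁻¹)) *
        (if b = 0 then 1 else 1 - u (x + b) * β)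
      else 1 - u x * (if c = 0 then β else (u (x + b + 1))⁻¹) - u (x + b) * β + u x * β)

/-- The weighted sum over the subsets of `a + d` positions among `x < p ≤ x + a + b + c + d`.
The first argument only has to be at least the number of positions. -/
noncomputable def certSum (u : ℕ → K) : ℕ → ℕ → ℕ → ℕ → ℕ → Bool → K → ℕ → K
  | _, 0, b, c, 0 => certBase u b c
  | 0, 0, _, _, _ + 1 => fun _ _ _ => 0
  | 0, _ + 1, _, _, _ => fun _ _ _ => 0
  | f + 1, 0, b, c, d + 1 => certStep u (certSum u f) 0 b c d
  | f + 1, a + 1, b, c, d => certStep u (certSum u f) a b c d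

theorem certSum_zero (u : ℕ → K) (f b c : ℕ) : certSum u f 0 b c 0 = certBase u b c := by
  cases f <;> rfl

theorem certSum_succ (u : ℕ → K) (f a b c d : ℕ) :
    certSum u (f + 1) (a + 1) b c d = certStep u (certSum u f) a b c d := rfl

/-- For a = 0 the recursion borrows one unit from d, so both sides unfold to the same step. -/
theorem certSum_zero_succ (u : ℕ → K) (f b c d : ℕ) :
    certSum u f 0 b c (d + 1) = certSum u f 1 b c d := by
  cases f <;> rfl

/-- The closed form of `certSum` for `d = 0`. -/
noncomputable def certVal (u : ℕ → K) (a b c : ℕ) (β : K) (x : ℕ) : K :=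
  (∏ p ∈ Finset.Ico (x + a + 1) (x + a + b + c + 1), u p) *
    (∏ p ∈ Finset.Ico (x + a + b + 1) (x + a + b + c + 1), u p) *
    (1 - u (x + a) * (if c = 0 then β else (u (x + a + b + 1))⁻¹) - u (x + a + b) * β
      + u (x + a) * β)

/-- Peel the outer pair. For d = 0 it cannot be wholly selected. Rewriting by `hM` the term that
selects only the left position produces exactly the negative of the term that selects neither, so
only sums with d = 0 and smaller a survive. The relation `hM` is assumed for smaller totals because
its own proof, `certSum_true`, uses this lemma. -/
theorem certSum_eq_certVal_of (u : ℕ → K) (f a b c : ℕ) (β : K) (x : ℕ)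
    (hf : a + b + c ≤ f) (hu : ∀ p, x < p → p ≤ x + a + b + c → u p ≠ 0)
    (hM : ∀ f' a' b' c' d' β' x', a' + b' + c' + d' < a + b + c → a' + b' + c' + d' ≤ f' →
      (∀ p, x' < p → p ≤ x' + a' + b' + c' + d' → u p ≠ 0) →
      certSum u f' a' b' c' d' true β' x' = certSum u f' a' b' c' d' false β' x'
        - u x' * (if 0 < b' then certSum u f' a' (b' - 1) c' (d' + 1) false β' x' else 0)) :
    certSum u f a b c 0 false β x = certVal u a b c β x := by
  induction a generalizing f b c β x with
  | zero => simp [certSum_zero, certBase, certVal]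
  | succ a ih =>
    obtain ⟨f, rfl⟩ : ∃ f', f = f' + 1 := ⟨f - 1, by omega⟩
    rw [certSum_succ, certStep]
    have IH : ∀ b' c' β', b' + c' < b + c →
        certSum u f a b' c' 0 false β' (x + 1) = certVal u a b' c' β' (x + 1) := by
      intro b' c' β' h
      exact ih f b' c' β' (x + 1) (by omega) (fun p h1 h2 => hu p (by omega) (by omega))
        (fun f' a' b'' c'' d' β'' x' h1 => hM f' a' b'' c'' d' β'' x' (by omega))
    rcases Nat.eq_zero_or_pos c with rfl | hc
    · rcases Nat.eq_zero_or_pos b with rfl | hb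
      · simp [certVal, add_assoc]
      · obtain ⟨b, rfl⟩ : ∃ b', b = b' + 1 := ⟨b - 1, by omega⟩
        have h1 := IH b 0 0 (by omega)
        simp only [certVal] at h1 ⊢
        rw [show x + 1 + a + 1 = x + a + 2 by ring,
          show x + 1 + a + b + 1 = x + a + b + 2 by ring] at h1
        rw [show x + (a + 1) + 1 = x + a + 2 by ring,
          show x + (a + (b + 1) + 0 + 0) + 1 = x + a + b + 2 by ring,
          show x + (a + 1) + (b + 1) + 1 = x + a + b + 2 + 1 by ring,
          show x + (a + 1) + (b + 1) = x + a + b + 2 by ring,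
          Finset.prod_Ico_succ_top (b := x + a + b + 2) (by omega)]
        simp [h1]
        ring
    · obtain ⟨c, rfl⟩ : ∃ c', c = c' + 1 := ⟨c - 1, by omega⟩
      have hR : u (x + a + b + c + 2) ≠ 0 := hu _ (by omega) (by omega)
      have h2 := IH b c (u (x + a + b + c + 2))⁻¹ (by omega)
      have hM1 := hM f a b c 0 (u (x + a + b + c + 2))⁻¹ (x + 1) (by omega)
        (by omega) (fun p h1 h2 => hu p (by omega) (by omega))
      simp only [certVal] at h2 ⊢
      rw [show x + 1 + a + 1 = x + a + 2 by ring,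
        show x + 1 + a + b + 1 = x + a + b + 2 by ring,
        show x + 1 + a + b + c + 1 = x + a + b + c + 2 by ring,
        show x + 1 + a + b = x + a + b + 1 by ring,
        show x + 1 + a = x + a + 1 by ring] at h2
      rw [show x + (a + 1) + 1 = x + a + 2 by ring,
        show x + (a + 1) + b + (c + 1) + 1 = x + a + b + c + 2 + 1 by ring,
        show x + (a + b + (c + 1) + 0) + 1 = x + a + b + c + 2 by ring,
        show x + (a + 1) + b + 1 = x + a + b + 2 by ring,
        show x + (a + 1) + b = x + a + b + 1 by ring,
        show x + (a + 1) = x + a + 1 by ring,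
        Finset.prod_Ico_succ_top (a := x + a + 2) (b := x + a + b + c + 2) (by omega),
        Finset.prod_Ico_succ_top (a := x + a + b + 2) (b := x + a + b + c + 2) (by omega)]
      -- For c = 0 the two positions x + a + b + c + 2 and x + a + b + 2 coincide.
      have hc0 : (if c = 0 then (u (x + a + b + c + 2))⁻¹ else (u (x + a + b + 2))⁻¹) =
          (u (x + a + b + 2))⁻¹ := by split_ifs with h <;> simp [h]
      rw [hc0] at h2
      rcases Nat.eq_zero_or_pos b with rfl | hb
      · simp only [lt_irrefl, if_false, mul_zero, sub_zero, add_zero] at hM1 h2 ⊢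
        simp [hM1, h2]
        ring
      · obtain ⟨b, rfl⟩ : ∃ b', b = b' + 1 := ⟨b - 1, by omega⟩
        have h3 := IH b (c + 1) 0 (by omega)
        simp only [certVal] at h3
        rw [show x + 1 + a + 1 = x + a + 2 by ring,
          show x + 1 + a + b + 1 = x + a + (b + 1) + 1 by ring,
          show x + 1 + a + b + (c + 1) + 1 = x + a + (b + 1) + c + 2 by ring,
          show x + 1 + a + b = x + a + b + 1 by ring,
          show x + 1 + a = x + a + 1 by ring,
          Finset.prod_eq_prod_Ico_succ_bot (a := x + a + (b + 1) + 1) (by omega)] at h3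
        have hP : u (x + a + (b + 1) + 1) ≠ 0 := hu _ (by omega) (by omega)
        simp [hM1, h2, h3]
        rw [show x + a + (b + 1) + 1 + 1 = x + a + (b + 1) + 2 by ring]
        field_simp
        ring

/-- The flag `l` enters only through the factor `1 - u x / u (x + 1)` of the two terms that leave
out the left position. In the step at (b - 1, d + 1), rewriting the two terms that select the left
position by `hM` cancels the other two, and what remains is `1 / u (x + 1)` times the terms in
question. -/
theorem certStep_true (u : ℕ → K) (f a b c d : ℕ) (β : K) (x : ℕ)
    (hu : u (x + 1) ≠ 0)
    (hM : ∀ b' c' d' β', b' + c' + d' < b + c + d →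
      certSum u f a b' c' d' true β' (x + 1) = certSum u f a b' c' d' false β' (x + 1)
        - u (x + 1) *
          (if 0 < b' then certSum u f a (b' - 1) c' (d' + 1) false β' (x + 1) else 0)) :
    certStep u (certSum u f) a b c d true β x = certStep u (certSum u f) a b c d false β x
      - u x * (if 0 < b then certStep u (certSum u f) a (b - 1) c (d + 1) false β x else 0) := by
  rcases Nat.eq_zero_or_pos b with rfl | hb
  · simp [certStep]
  obtain ⟨b, rfl⟩ : ∃ b', b = b' + 1 := ⟨b - 1, by omega⟩
  have h1 := hM b c d 0 (by omega)
  rcases Nat.eq_zero_or_pos c with rfl | hc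
  · simp [certStep, h1, show a + (b + 1) + d = a + b + (d + 1) by ring]
    split_ifs <;> field_simp <;> ring
  · obtain ⟨c, rfl⟩ : ∃ c', c = c' + 1 := ⟨c - 1, by omega⟩
    have h2 := hM b c (d + 1) (u (x + (a + b + (c + 1) + (d + 1)) + 1))⁻¹ (by omega)
    simp [certStep, h1, h2, show a + (b + 1) + (c + 1) + d = a + b + (c + 1) + (d + 1) by ring]
    split_ifs <;> field_simp <;> ring

theorem certSum_true (u : ℕ → K) (f a b c d : ℕ) (β : K) (x : ℕ) (hf : a + b + c + d ≤ f)
    (hu : ∀ p, x < p → p ≤ x + a + b + c + d → u p ≠ 0) :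
    certSum u f a b c d true β x = certSum u f a b c d false β x
      - u x * (if 0 < b then certSum u f a (b - 1) c (d + 1) false β x else 0) := by
  induction hn : a + b + c + d using Nat.strong_induction_on generalizing f a b c d β x with
  | _ n ih =>
    subst hn
    have step : ∀ f a b c d, a + 1 + b + c + d ≤ f + 1 →
        (∀ p, x < p → p ≤ x + (a + 1) + b + c + d → u p ≠ 0) → 
        (∀ b' c' d' β', b' + c' + d' < b + c + d →
          certSum u f a b' c' d' true β' (x + 1) = certSum u f a b' c' d' false β' (x + 1)
          - u (x + 1) *
          (if 0 < b' then certSum u f a (b' - 1) c' (d' + 1) false β' (x + 1) else 0)) →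
        certSum u (f + 1) (a + 1) b c d true β x = certSum u (f + 1) (a + 1) b c d false β x
          - u x * (if 0 < b then certSum u (f + 1) (a + 1) (b - 1) c (d + 1) false β x else 0) := by
      intro f a b c d _ h1 h2
      exact certStep_true u f a b c d β x (h1 _ (by omega) (by omega)) h2
    rcases a with _ | a
    · rcases d with _ | d
      · rcases b with _ | b
        · simp [certSum_zero, certBase]
        -- For a = d = 0 the left side is a starting value, not a step. The right side involves a
        -- one-element subset, whose closed form is available because `ih` supplies the relation for
        -- smaller totals.
        · have := certSum_eq_certVal_of u f 1 b c β x (by omega)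
            (fun p h1 h2 => hu p h1 (by omega))
            (fun f' a' b' c' d' β' x' h1 h2 h3 => ih _ (by omega) f' a' b' c' d' β' x' h2 h3 rfl)
          rw [if_pos (by omega), certSum_zero, certSum_zero_succ, Nat.add_sub_cancel, this,
            certBase, certBase, certVal]
          rw [show x + (b + 1) + c + 1 = x + b + c + 2 by ring,
            show x + 1 + b + c + 1 = x + b + c + 2 by ring,
            show x + (b + 1) + 1 = x + b + 2 by ring,
            show x + 1 + b + 1 = x + b + 2 by ring,
            show x + (b + 1) = x + b + 1 by ring,
            show x + 1 + b = x + b + 1 by ring,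
            Finset.prod_eq_prod_Ico_succ_bot (a := x + 1) (by omega)]
          have h1 : u (x + 1) ≠ 0 := hu _ (by omega) (by omega)
          generalize (if c = 0 then β else (u (x + b + 2))⁻¹) = ξ
          simp
          field_simp
          ring
      · obtain ⟨f, rfl⟩ : ∃ f', f = f' + 1 := ⟨f - 1, by omega⟩
        rw [certSum_zero_succ, certSum_zero_succ]
        refine step f 0 b c d (by omega) (fun p h1 h2 => hu p h1 (by omega)) ?_
        intro b' c' d' β' h
        exact ih _ (by omega) _ _ _ _ _ _ _ (by omega)
          (fun p h1 h2 => hu p (by omega) (by omega)) rfl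
    · obtain ⟨f, rfl⟩ : ∃ f', f = f' + 1 := ⟨f - 1, by omega⟩
      refine step f a b c d (by omega) hu ?_
      intro b' c' d' β' h
      exact ih _ (by omega) _ _ _ _ _ _ _ (by omega)
        (fun p h1 h2 => hu p (by omega) (by omega)) rfl

theorem certSum_eq_certVal (u : ℕ → K) (f a b c : ℕ) (β : K) (x : ℕ)
    (hf : a + b + c ≤ f) (hu : ∀ p, x < p → p ≤ x + a + b + c → u p ≠ 0) :
    certSum u f a b c 0 false β x = certVal u a b c β x :=
  certSum_eq_certVal_of u f a b c β x hf hu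
    fun f' a' b' c' d' β' x' _ h => certSum_true u f' a' b' c' d' β' x' h

end Certificate

/-! ### The weight of a sequence and its behaviour under translation. -/

section Weight

variable {K : Type*} [Field K]

/-- `q ^ N p` for `p ≥ 1`, with the convention `0` for `p = 0`. -/
noncomputable def qPow (q : K) (N : ℕ → ℤ) (p : ℕ) : K :=
  if p = 0 then 0 else q ^ N p

/-- The factor of the weight that links the positions `x` and `x + 1`. -/
noncomputable def link (rp : ℤ → K) (x : ℕ) (N : ℕ → ℤ) : K :=
  if x = 0 then 1 else rp (N x - N (x + 1))

/-- The weight of the entries of `N` at the positions `x < p ≤ x + n`. -/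
noncomputable def weight (q : K) (rp : ℤ → K) : ℕ → ℕ → (ℕ → ℤ) → K
  | x, 0, N => link rp x N
  | x, 1, N => link rp x N * link rp (x + 1) N * q ^ (3 * (N (x + 1) * (N (x + 1) - 1)) / 2)
  | x, n + 2, N => link rp x N * link rp (x + n + 2) N *
      q ^ (N (x + 1) * (N (x + 1) - 1) + N (x + n + 2) * (N (x + n + 2) - 1)
        + (N (x + 1) - 1) * N (x + n + 2)) * weight q rp (x + 1) n N

/-- `1` for `true` and `0` for `false`. -/
def bit (l : Bool) : ℤ := if l then 1 else 0

theorem weight_congr (q : K) (rp : ℤ → K) (x n : ℕ) (N N' : ℕ → ℤ)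
    (h : ∀ p, x ≤ p → p ≤ x + n + 1 → N p = N' p) : weight q rp x n N = weight q rp x n N' := by
  have hl : ∀ y, x ≤ y → y ≤ x + n → link rp y N = link rp y N' := by
    intro y h1 h2
    simp only [link, h y h1 (by omega), h (y + 1) (by omega) (by omega)]
  match n with
  | 0 => exact hl x le_rfl (by omega)
  | 1 => simp only [weight, hl x le_rfl (by omega), hl (x + 1) (by omega) (by omega),
      h (x + 1) (by omega) (by omega)]
  | n + 2 =>
    simp only [weight, hl x le_rfl (by omega), hl (x + n + 2) (by omega) (by omega),
      h (x + 1) (by omega) (by omega), h (x + n + 2) (by omega) (by omega),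
      weight_congr q rp (x + 1) n N N' fun p h1 h2 => h p (by omega) (by omega)]

/-- The two outer links are the only factors that see the positions x and x + n + 1. For n = 0 they
would be one and the same factor. -/
theorem exists_weight_eq (q : K) (rp : ℤ → K) (x n : ℕ) (hn : n ≠ 0) (N N' : ℕ → ℤ)
    (h : ∀ p, x < p → p ≤ x + n → N p = N' p) :
    ∃ W, weight q rp x n N = link rp x N * link rp (x + n) N * W ∧
      weight q rp x n N' = link rp x N' * link rp (x + n) N' * W := by
  match n, hn with
  | 1, _ => exact ⟨_, rfl, by simp only [weight, h (x + 1) (by omega) (by omega)]⟩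
  | n + 2, _ =>
    refine ⟨_, (by rw [weight, mul_assoc]; rfl), ?_⟩
    rw [weight, h (x + 1) (by omega) (by omega), h (x + n + 2) (by omega) (by omega),
      weight_congr q rp (x + 1) n N N' fun p h1 h2 => h p (by omega) (by omega), mul_assoc]
    rfl

/-- The difference `N x - N (x + 1)` changes by at most one unit, which `hrp` turns into a factor `1
- U_x / U_{x+1}` on one side. At x = 0 the conventions make every factor 1. The lemma also serves
the right end of an interval. -/
theorem link_mul_left (q : K) (rp : ℤ → K) (hq : q ≠ 0)
    (hrp : ∀ m : ℤ, rp m * (1 - q ^ m) = rp (m - 1)) (x : ℕ) (N e : ℕ → ℤ) (l l' : Bool)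
    (h1 : e x = bit l) (h2 : e (x + 1) = bit l') :
    link rp x (N + e) * (if l && !l' then 1 - qPow q (N + e) x * (qPow q (N + e) (x + 1))⁻¹ else 1)
      = link rp x N * (if !l && l' then 1 - qPow q N x * (qPow q N (x + 1))⁻¹ else 1) := by
  rcases Nat.eq_zero_or_pos x with rfl | hx
  · simp [link, qPow]
  · have key : ∀ M : ℕ → ℤ, qPow q M x * (qPow q M (x + 1))⁻¹ = q ^ (M x - M (x + 1)) := by
      intro M
      rw [qPow, qPow, if_neg hx.ne', if_neg (by omega), zpow_sub₀ hq, div_eq_mul_inv]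
    simp only [key, link, if_neg hx.ne', Pi.add_apply, h1, h2]
    cases l <;> cases l' <;> simp [bit]
    · rw [hrp]; congr 1; ring
    · rw [hrp]; congr 1; ring

/-! ### Certificates: combinations of translations by subsets. -/

/-- The relation that a sum over subsets of the positions `x < p ≤ x + n` of size `s`, with
weights on both sides of the translation by the indicator function, certifies. -/
inductive Cert (q : K) (rp : ℤ → K) (x n : ℕ) (l r : Bool) (s : ℤ) :
    ((ℕ → ℤ) → K) → ((ℕ → ℤ) → K) → Prop
  | zero : Cert q rp x n l r s (fun _ => 0) (fun _ => 0)
  | add {A B A' B' : (ℕ → ℤ) → K} : Cert q rp x n l r s A B → Cert q rp x n l r s A' B' →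
      Cert q rp x n l r s (fun N => A N + A' N) (fun N => B N + B' N)
  | single {A B : (ℕ → ℤ) → K} (e : ℕ → ℤ) (hs : ∑ p ∈ Finset.Ico (x + 1) (x + n + 1), e p = s)
      (h : ∀ N e' : ℕ → ℤ, (∀ p, x < p → p ≤ x + n → e' p = e p) → e' x = bit l →
        e' (x + n + 1) = bit r →
        weight q rp x n (N + e') * A (N + e') = weight q rp x n N * B N) :
      Cert q rp x n l r s A B

theorem Cert.congr {q : K} {rp : ℤ → K} {x n : ℕ} {l r : Bool} {s s' : ℤ}
    {A B A' B' : (ℕ → ℤ) → K} (h : Cert q rp x n l r s A B) (hs : s = s')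
    (hA : ∀ N, A N = A' N) (hB : ∀ N, B N = B' N) : Cert q rp x n l r s' A' B' := by
  subst hs
  rwa [← funext hA, ← funext hB]

theorem Cert.ite {q : K} {rp : ℤ → K} {x n : ℕ} {l r : Bool} {s : ℤ}
    {A B : (ℕ → ℤ) → K} (P : Prop) [Decidable P] (h : P → Cert q rp x n l r s A B) :
    Cert q rp x n l r s (fun N => if P then A N else 0) (fun N => if P then B N else 0) := by
  by_cases hP : P
  · simpa [hP] using h hP
  · simpa [hP] using Cert.zero

/-- Every subset of the inner interval is extended by the choices `l'`, `r'` at the two new outer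
positions. The two new links are handled by `link_mul_left`, and `hm` matches the monomials `mA`,
`mB` with the change of the exponent of the outer pair. -/
theorem Cert.peel {q : K} {rp : ℤ → K} (hq : q ≠ 0)
    (hrp : ∀ m : ℤ, rp m * (1 - q ^ m) = rp (m - 1)) {x n : ℕ} {l r : Bool} (l' r' : Bool) {s : ℤ}
    {A B : (ℕ → ℤ) → K} (h : Cert q rp (x + 1) n l' r' s A B) (mA mB : K → K → K)
    (hm : ∀ i j : ℤ, q ^ ((i + bit l') * (i + bit l' - 1) + (j + bit r') * (j + bit r' - 1)
        + (i + bit l' - 1) * (j + bit r')) * mA (q ^ (i + bit l')) (q ^ (j + bit r')) =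
      q ^ (i * (i - 1) + j * (j - 1) + (i - 1) * j) * mB (q ^ i) (q ^ j)) :
    Cert q rp x (n + 2) l r (s + bit l' + bit r')
      (fun N => (if l && !l' then 1 - qPow q N x * (qPow q N (x + 1))⁻¹ else 1) *
        (if r' && !r then 1 - qPow q N (x + n + 2) * (qPow q N (x + n + 3))⁻¹ else 1) *
        mA (qPow q N (x + 1)) (qPow q N (x + n + 2)) * A N)
      (fun N => (if !l && l' then 1 - qPow q N x * (qPow q N (x + 1))⁻¹ else 1) *
        (if !r' && r then 1 - qPow q N (x + n + 2) * (qPow q N (x + n + 3))⁻¹ else 1) *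
        mB (qPow q N (x + 1)) (qPow q N (x + n + 2)) * B N) := by
  induction h with
  | zero => simpa using Cert.zero
  | add _ _ h1 h2 => exact (h1.add h2).congr rfl (fun N => by ring) (fun N => by ring)
  | @single A B e hs h =>
    refine Cert.single
      (fun p => if p = x + 1 then bit l' else if p = x + n + 2 then bit r' else e p) ?_ ?_
    · have h1 : ∑ p ∈ Finset.Ico (x + 1 + 1) (x + 1 + n + 1),
          (if p = x + 1 then bit l' else if p = x + n + 2 then bit r' else e p) = s := by
        rw [← hs]
        refine Finset.sum_congr rfl fun p hp => ?_
        rw [Finset.mem_Ico] at hp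
        rw [if_neg (by omega), if_neg (by omega)]
      rw [show x + (n + 2) + 1 = x + n + 2 + 1 by ring,
        Finset.sum_Ico_succ_top (b := x + n + 2) (by omega),
        Finset.sum_eq_sum_Ico_succ_bot (by omega), if_pos rfl, if_neg (by omega), if_pos rfl,
        show x + n + 2 = x + 1 + n + 1 by ring, ← show x + n + 2 = x + 1 + n + 1 by ring]
      rw [show x + 1 + n + 1 = x + n + 2 by ring] at h1
      rw [h1]
      ring
    · intro N e' he hx hy
      have h1 := he (x + 1) (by omega) (by omega)
      have h2 := he (x + n + 2) (by omega) (by omega)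
      rw [if_pos rfl] at h1
      rw [if_neg (by omega), if_pos rfl] at h2
      have hin := h N e' (fun p h3 h4 => by
        rw [he p (by omega) (by omega), if_neg (by omega), if_neg (by omega)]) h1
        (by rw [show x + 1 + n + 1 = x + n + 2 by ring, h2])
      have hl := link_mul_left q rp hq hrp x N e' l l' hx h1
      have hr := link_mul_left q rp hq hrp (x + n + 2) N e' r' r h2 hy
      have hm' := hm (N (x + 1)) (N (x + n + 2))
      have hP : ∀ M, q ^ M (x + 1) = qPow q M (x + 1) := fun M => (if_neg (by omega)).symm
      have hR : ∀ M, q ^ M (x + n + 2) = qPow q M (x + n + 2) := fun M => (if_neg (by omega)).symm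
      have hP' := hP (N + e')
      have hR' := hR (N + e')
      simp only [Pi.add_apply, h1, h2] at hP' hR'
      rw [hP', hR', hP, hR] at hm'
      simp only [weight, Pi.add_apply, h1, h2]
      calc _ = _ * _ * _ * _ := ?_
        _ = _ := congrArg₂ (· * ·) (congrArg₂ (· * ·) (congrArg₂ (· * ·) hl hr) hm') hin
        _ = _ := ?_
      · ring
      · ring

/-! ### The companion sum, and the certificate relating it to the original one. -/

/-- The reversed and inverted sequence. -/
noncomputable def rev (u : ℕ → K) (x n : ℕ) (p : ℕ) : K := (u (2 * x + n + 1 - p))⁻¹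

/-- The companion of `certSum` on the other side of the translation. -/
noncomputable def dualSum (u : ℕ → K) (f a b c d : ℕ) (r : Bool) (α : K) (x : ℕ) : K :=
  (∏ p ∈ Finset.Ico (x + 1) (x + (a + b + c + d) + 1), u p) ^ 3 *
    certSum (rev u x (a + b + c + d)) f a c b d r α x

theorem prod_rev (u : ℕ → K) (x n i j : ℕ) (h : j ≤ 2 * x + n + 2) :
    ∏ p ∈ Finset.Ico i j, rev u x n p =
      (∏ p ∈ Finset.Ico (2 * x + n + 2 - j) (2 * x + n + 2 - i), u p)⁻¹ := by
  rw [← Finset.prod_inv_distrib]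
  exact Finset.prod_Ico_reflect (fun p => (u p)⁻¹) i (by omega)

theorem dualSum_zero_succ (u : ℕ → K) (f b c d : ℕ) (r : Bool) (α : K) (x : ℕ) :
    dualSum u f 0 b c (d + 1) r α x = dualSum u f 1 b c d r α x := by
  rw [dualSum, dualSum, certSum_zero_succ, show 0 + b + c + (d + 1) = 1 + b + c + d by ring]

theorem dualSum_full (u : ℕ → K) (f a : ℕ) (r : Bool) (α : K) (x : ℕ) :
    dualSum u (f + 1) (a + 1) 0 0 0 r α x =
      (∏ p ∈ Finset.Ico (x + 1) (x + (a + 1) + 1), u p) ^ 3 * (1 - (u (x + 1))⁻¹ * α) := by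
  rw [dualSum, certSum_succ, certStep, if_pos ⟨rfl, rfl, rfl⟩, rev]
  congr 4
  congr 1
  omega

/-- Reversal exchanges left and right, hence the roles of b and c. The monomials are those of
`certStep` inverted and multiplied by the cubes of the two outer values. -/
theorem dualSum_succ (u : ℕ → K) (f a b c d : ℕ) (r : Bool) (α : K) (x : ℕ)
    (h0 : ¬ (b = 0 ∧ c = 0 ∧ d = 0)) (hP : u (x + 1) ≠ 0)
    (hR : u (x + (a + b + c + d) + 1) ≠ 0) :
    dualSum u (f + 1) (a + 1) b c d r α x =
      (if r then 1 - u (x + (a + b + c + d) + 1) * (u (x + (a + b + c + d) + 2))⁻¹ else 1) *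
        (if 0 < b ∧ 0 < c then u (x + 1) * u (x + (a + b + c + d) + 1) ^ 2 *
          dualSum u f a (b - 1) (c - 1) (d + 1) false (u (x + 1)) (x + 1) else 0)
      + (if 0 < b then u (x + 1) * u (x + (a + b + c + d) + 1) ^ 3 *
          dualSum u f a (b - 1) c d true (u (x + 1)) (x + 1) else 0)
      + (if r then 1 - u (x + (a + b + c + d) + 1) * (u (x + (a + b + c + d) + 2))⁻¹ else 1) *
        (1 - α * (u (x + 1))⁻¹) *
        (if 0 < c then u (x + 1) ^ 2 * u (x + (a + b + c + d) + 1) ^ 3 *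
          dualSum u f a b (c - 1) d false 0 (x + 1) else 0)
      + (1 - α * (u (x + 1))⁻¹) *
        (if 0 < d then u (x + 1) ^ 2 * u (x + (a + b + c + d) + 1) ^ 4 *
          dualSum u f a b c (d - 1) true 0 (x + 1) else 0) := by
  have hin : ∀ a' b' c' d', a' + b' + c' + d' + 1 = a + b + c + d → ∀ r' α',
      dualSum u f a' b' c' d' r' α' (x + 1) =
        (∏ p ∈ Finset.Ico (x + 1 + 1) (x + (a + b + c + d) + 1), u p) ^ 3 *
          certSum (rev u x (a + 1 + b + c + d)) f a' c' b' d' r' α' (x + 1) := by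
    intro a' b' c' d' h r' α'
    have : rev u (x + 1) (a' + b' + c' + d') = rev u x (a + 1 + b + c + d) := by
      funext p
      simp only [rev]
      congr 2
      omega
    rw [dualSum, this, show x + 1 + (a' + b' + c' + d') + 1 = x + (a + b + c + d) + 1 by omega]
  have r1 : rev u x (a + 1 + b + c + d) x = (u (x + (a + b + c + d) + 2))⁻¹ := by
    rw [rev]; congr 2; omega
  have r2 : rev u x (a + 1 + b + c + d) (x + 1) = (u (x + (a + b + c + d) + 1))⁻¹ := by
    rw [rev]; congr 2; omega
  have r3 : rev u x (a + 1 + b + c + d) (x + (a + c + b + d) + 1) = (u (x + 1))⁻¹ := by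
    rw [rev]; congr 2; omega
  have hprod : ∏ p ∈ Finset.Ico (x + 1) (x + (a + 1 + b + c + d) + 1), u p =
      u (x + 1) * (∏ p ∈ Finset.Ico (x + 1 + 1) (x + (a + b + c + d) + 1), u p) *
        u (x + (a + b + c + d) + 1) := by
    rw [show x + (a + 1 + b + c + d) + 1 = x + (a + b + c + d) + 1 + 1 by ring,
      Finset.prod_Ico_succ_top (b := x + (a + b + c + d) + 1) (by omega),
      Finset.prod_eq_prod_Ico_succ_bot (by omega)]
  rw [dualSum, certSum_succ, certStep, if_neg (by tauto), r1, r2, r3, hprod]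
  simp only [inv_inv]
  have e1 : 0 < c ∧ 0 < b ↔ 0 < b ∧ 0 < c := and_comm
  simp only [e1]
  have hite : ∀ (P : Prop) [Decidable P] (k v : K), (if P then k * v else 0) =
      k * (if P then v else 0) := fun P _ k v => (mul_ite_zero P k v).symm
  have key : ∀ (P : Prop) [Decidable P] (v v' : K), (P → v = (∏ p ∈ Finset.Ico (x + 1 + 1)
      (x + (a + b + c + d) + 1), u p) ^ 3 * v') → (if P then v else 0) = (∏ p ∈
      Finset.Ico (x + 1 + 1) (x + (a + b + c + d) + 1), u p) ^ 3 * (if P then v' else 0) := by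
    intro P _ v v' h
    split_ifs with hP
    · exact h hP
    · simp
  simp only [hite]
  rw [key _ _ _ fun h => hin a (b - 1) (c - 1) (d + 1) (by omega) false (u (x + 1)),
    key _ _ _ fun h => hin a (b - 1) c d (by omega) true (u (x + 1)),
    key _ _ _ fun h => hin a b (c - 1) d (by omega) false 0,
    key _ _ _ fun h => hin a b c (d - 1) (by omega) true 0]
  generalize (∏ p ∈ Finset.Ico (x + 1 + 1) (x + (a + b + c + d) + 1), u p) = Z
  generalize u (x + (a + b + c + d) + 1) = y at *
  generalize u (x + 1) = z at *
  rw [mul_comm (u (x + (a + b + c + d) + 2))⁻¹ y]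
  generalize (if r then 1 - y * (u (x + (a + b + c + d) + 2))⁻¹ else 1) = ρ
  generalize (if 0 < b ∧ 0 < c then _ else (0 : K)) = t1
  generalize (if 0 < b then _ else (0 : K)) = t2
  generalize (if 0 < c then _ else (0 : K)) = t3
  generalize (if 0 < d then _ else (0 : K)) = t4
  field_simp

theorem qPow_ne_zero {q : K} (hq : q ≠ 0) (N : ℕ → ℤ) {p : ℕ} (hp : p ≠ 0) :
    qPow q N p ≠ 0 := by
  rw [qPow, if_neg hp]
  exact zpow_ne_zero _ hq

theorem qPow_add {q : K} (N e : ℕ → ℤ) {p : ℕ} (h : e p = 0) : qPow q (N + e) p = qPow q N p := by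
  simp [qPow, h]

theorem prod_Ico_peel (u : ℕ → K) (x n : ℕ) :
    ∏ p ∈ Finset.Ico (x + 1) (x + (n + 2) + 1), u p =
      u (x + 1) * (∏ p ∈ Finset.Ico (x + 1 + 1) (x + 1 + n + 1), u p) * u (x + n + 2) := by
  rw [show x + (n + 2) + 1 = x + n + 2 + 1 by ring,
    Finset.prod_Ico_succ_top (b := x + n + 2) (by omega),
    Finset.prod_eq_prod_Ico_succ_bot (by omega), show x + 1 + n + 1 = x + n + 2 by ring]

theorem zpow_full {q : K} (hq : q ≠ 0) (i j : ℤ) :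
    q ^ ((i + bit true) * (i + bit true - 1) + (j + bit true) * (j + bit true - 1)
        + (i + bit true - 1) * (j + bit true)) * 1 =
      q ^ (i * (i - 1) + j * (j - 1) + (i - 1) * j) * ((q ^ i) ^ 3 * (q ^ j) ^ 3) := by
  rw [mul_one, ← zpow_natCast, ← zpow_natCast, ← zpow_mul, ← zpow_mul, ← zpow_add₀ hq,
    ← zpow_add₀ hq]
  congr 1
  simp [bit]
  ring

theorem one_sub_ite_left (u v : K) (l : Bool) :
    1 - v⁻¹ * (if l then 0 else u) = if !l && true then 1 - u * v⁻¹ else 1 := by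
  cases l <;> simp [mul_comm]

theorem one_sub_ite_right (u v : K) (r : Bool) :
    1 - u * (if r then 0 else v⁻¹) = if true && !r then 1 - u * v⁻¹ else 1 := by
  cases r <;> simp

theorem cert_one {q : K} {rp : ℤ → K} (hq : q ≠ 0)
    (hrp : ∀ m : ℤ, rp m * (1 - q ^ m) = rp (m - 1)) (x : ℕ) (l r : Bool) :
    Cert q rp x 1 l r 1
      (fun N => 1 - qPow q N (x + 1) * (if r then 0 else (qPow q N (x + 2))⁻¹))
      (fun N => qPow q N (x + 1) ^ 3 *
        (1 - (qPow q N (x + 1))⁻¹ * (if l then 0 else qPow q N x))) := by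
  refine Cert.single (fun _ => 1) (by simp) fun N e' h0 h1 h2 => ?_
  have h3 : e' (x + 1) = bit true := h0 (x + 1) (by omega) (by omega)
  have hl := link_mul_left q rp hq hrp x N e' l true h1 h3
  have hr := link_mul_left q rp hq hrp (x + 1) N e' true r h3 h2
  -- At an unpaired middle position, raising N by 1 raises 3N(N - 1)/2 by 3N.
  have h4 : 3 * ((N + e') (x + 1) * ((N + e') (x + 1) - 1)) / 2 =
      3 * (N (x + 1) * (N (x + 1) - 1)) / 2 + 3 * N (x + 1) := by
    rw [Pi.add_apply, h3, bit, if_pos rfl, ← Int.add_mul_ediv_right _ _ (by norm_num)]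
    congr 1
    ring
  have hq3 : q ^ (3 * N (x + 1)) = qPow q N (x + 1) ^ 3 := by
    rw [zpow_mul' q 3]
    simp [qPow]
  rw [weight, weight, h4, zpow_add₀ hq, hq3, one_sub_ite_left, one_sub_ite_right]
  simp only [Bool.not_true, Bool.and_false, Bool.false_eq_true, if_false, mul_one,
    Bool.false_and] at hl hr
  calc _ = _ * _ * (q ^ (3 * (N (x + 1) * (N (x + 1) - 1)) / 2) * qPow q N (x + 1) ^ 3) := ?_
    _ = _ := congrArg₂ (· * ·) (congrArg₂ (· * ·) hl hr) rfl
    _ = _ := ?_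
  · ring
  · ring

theorem cert_full_true {q : K} {rp : ℤ → K} (hq : q ≠ 0)
    (hrp : ∀ m : ℤ, rp m * (1 - q ^ m) = rp (m - 1)) (x n : ℕ) :
    Cert q rp x n true true n (fun _ => 1)
      (fun N => (∏ p ∈ Finset.Ico (x + 1) (x + n + 1), qPow q N p) ^ 3) := by
  induction n using Nat.twoStepInduction generalizing x with
  | zero =>
    refine Cert.single 0 (by simp) fun N e' _ h1 h2 => ?_
    have := link_mul_left q rp hq hrp x N e' true true h1 h2
    simpa [weight] using this
  | one => exact (cert_one hq hrp x true true).congr rfl (fun N => by simp) (fun N => by simp)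
  | more n ih _ =>
    have := (ih (x + 1)).peel hq hrp (x := x) (l := true) (r := true) true true
      (fun _ _ => 1) (fun i j => i ^ 3 * j ^ 3) (zpow_full hq)
    refine this.congr (by simp [bit]; ring) (fun N => by simp) fun N => ?_
    rw [prod_Ico_peel]
    simp
    ring

theorem cert_full {q : K} {rp : ℤ → K} (hq : q ≠ 0)
    (hrp : ∀ m : ℤ, rp m * (1 - q ^ m) = rp (m - 1)) (x n : ℕ) (l r : Bool) :
    Cert q rp x (n + 1) l r (n + 1 : ℕ)
      (fun N => 1 - qPow q N (x + n + 1) * (if r then 0 else (qPow q N (x + n + 2))⁻¹))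
      (fun N => (∏ p ∈ Finset.Ico (x + 1) (x + (n + 1) + 1), qPow q N p) ^ 3 *
        (1 - (qPow q N (x + 1))⁻¹ * (if l then 0 else qPow q N x))) := by
  rcases n with _ | n
  · exact (cert_one hq hrp x l r).congr rfl (fun N => by simp) (fun N => by simp)
  · have := (cert_full_true hq hrp (x + 1) n).peel hq hrp (x := x) (l := l) (r := r) true true
      (fun _ _ => 1) (fun i j => i ^ 3 * j ^ 3) (zpow_full hq)
    refine this.congr (by simp [bit]) (fun N => ?_) fun N => ?_
    · rw [one_sub_ite_right]
      simp [add_assoc]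
    · rw [one_sub_ite_left, show x + (n + 1 + 1) + 1 = x + (n + 2) + 1 by ring, prod_Ico_peel]
      simp
      ring_nf

theorem dualSum_zero (u : ℕ → K) (f b c : ℕ) (r : Bool) (α : K) (x : ℕ)
    (hu : ∀ p, x < p → p ≤ x + b + c → u p ≠ 0) :
    dualSum u f 0 b c 0 r α x =
      (∏ p ∈ Finset.Ico (x + 1) (x + b + c + 1), u p) *
      (∏ p ∈ Finset.Ico (x + b + 1) (x + b + c + 1), u p) *
      (if r then (1 - (u (x + b + c + 1))⁻¹ * (if b = 0 ∧ c = 0 then α else u (x + b + c))) *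
          (if c = 0 then 1 else 1 - (u (x + b + 1))⁻¹ * α)
        else 1 - (u (x + b + c + 1))⁻¹ * (if b = 0 then α else u (x + b))
          - (u (x + b + 1))⁻¹ * α + (u (x + b + c + 1))⁻¹ * α) := by
  have hne : ∀ i j, x < i → j ≤ x + b + c + 1 → ∏ p ∈ Finset.Ico i j, u p ≠ 0 := by
    intro i j h1 h2
    rw [Finset.prod_ne_zero_iff]
    intro p hp
    rw [Finset.mem_Ico] at hp
    exact hu p (by omega) (by omega)
  have h1 := hne (x + 1) (x + b + 1) (by omega) (by omega)
  have h2 := hne (x + b + 1) (x + b + c + 1) (by omega) (by omega)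
  have h3 := Finset.prod_Ico_consecutive u (m := x + 1) (n := x + b + 1) (k := x + b + c + 1)
    (by omega) (by omega)
  rw [dualSum, certSum_zero, certBase, prod_rev _ _ _ _ _ (by omega), prod_rev _ _ _ _ _ (by omega)]
  simp only [rev]
  rw [show 0 + b + c + 0 = b + c by ring, ← add_assoc x b c,
    show 2 * x + (b + c) + 2 - (x + c + b + 1) = x + 1 by omega,
    show 2 * x + (b + c) + 2 - (x + 1) = x + b + c + 1 by omega,
    show 2 * x + (b + c) + 2 - (x + c + 1) = x + b + 1 by omega,
    show 2 * x + (b + c) + 1 - x = x + b + c + 1 by omega,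
    show 2 * x + (b + c) + 1 - (x + 1) = x + b + c by omega,
    show 2 * x + (b + c) + 1 - (x + c + 1) = x + b by omega,
    show 2 * x + (b + c) + 1 - (x + c) = x + b + 1 by omega, ← h3]
  simp only [inv_inv, and_comm (a := c = 0)]
  field_simp

/-- No position is selected, so the translation acts only on the boundary values prescribed by `l`
and `r`. Only the two outer links change. -/
theorem cert_base {q : K} {rp : ℤ → K} (hq : q ≠ 0)
    (hrp : ∀ m : ℤ, rp m * (1 - q ^ m) = rp (m - 1)) (f b c x : ℕ) (l r : Bool) :
    Cert q rp x (b + c) l r 0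
      (fun N => certSum (qPow q N) f 0 b c 0 l
        (if r then 0 else (qPow q N (x + (b + c) + 1))⁻¹) x)
      (fun N => dualSum (qPow q N) f 0 b c 0 r (if l then 0 else qPow q N x) x) := by
  refine Cert.single 0 (by simp) fun N e' h0 h1 h2 => ?_
  have hu : ∀ p, x < p → qPow q N p ≠ 0 := fun p hp => qPow_ne_zero hq N (by omega)
  have hin : ∀ p, x < p → p ≤ x + b + c → qPow q (N + e') p = qPow q N p := fun p h3 h4 =>
    qPow_add N e' (h0 p h3 (by omega))
  rw [dualSum_zero _ _ _ _ _ _ _ fun p h _ => hu p h, certSum_zero, certBase,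
    Finset.prod_congr rfl fun p hp => hin p (by simp at hp; omega) (by simp at hp; omega),
    Finset.prod_congr rfl fun p hp => hin p (by simp at hp; omega) (by simp at hp; omega)]
  rw [← add_assoc x b c] at *
  rcases Nat.eq_zero_or_pos (b + c) with hn | hn
  · obtain ⟨rfl, rfl⟩ : b = 0 ∧ c = 0 := by omega
    have hl := link_mul_left q rp hq hrp x N e' l r h1 h2
    have hx : l = false → qPow q (N + e') x = qPow q N x := by
      rintro rfl; exact qPow_add N e' h1
    have hy : r = false → qPow q (N + e') (x + 1) = qPow q N (x + 1) := by
      rintro rfl; exact qPow_add N e' h2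
    simp only [weight, add_zero]
    cases l <;> cases r <;> simp at hl hx hy ⊢
    · rw [hl, hx, hy]; ring
    · rw [hl]; ring
    · rw [hl]
    · rw [hl]
  · obtain ⟨W, hW, hW'⟩ := exists_weight_eq q rp x (b + c) (by omega) (N + e') N fun p h3 h4 => by
      simp [h0 p h3 (by omega)]
    have hl := link_mul_left q rp hq hrp x N e' l false h1 (h0 (x + 1) (by omega) (by omega))
    have hr := link_mul_left q rp hq hrp (x + b + c) N e' false r
      (h0 (x + b + c) (by omega) (by omega)) h2
    have hx : l = false → qPow q (N + e') x = qPow q N x := by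
      rintro rfl; exact qPow_add N e' h1
    have hy : r = false → qPow q (N + e') (x + b + c + 1) = qPow q N (x + b + c + 1) := by
      rintro rfl; exact qPow_add N e' h2
    have h1' := hin (x + 1) (by omega) (by omega)
    have h3 : b ≠ 0 → qPow q (N + e') (x + b) = qPow q N (x + b) := fun h =>
      hin _ (by omega) (by omega)
    have h4 : c ≠ 0 → qPow q (N + e') (x + b + 1) = qPow q N (x + b + 1) := fun h =>
      hin _ (by omega) (by omega)
    have hne : ¬ (b = 0 ∧ c = 0) := by omega
    rw [hW, hW', h1', if_neg hne, if_neg hne]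
    rw [← add_assoc x b c]
    rw [h1'] at hl
    generalize (∏ p ∈ Finset.Ico (x + 1) (x + b + c + 1), qPow q N p) *
      (∏ p ∈ Finset.Ico (x + b + 1) (x + b + c + 1), qPow q N p) = C
    have h5 : l = false → qPow q (N + e') (x + b) = qPow q N (x + b) := fun h => by
      rcases Nat.eq_zero_or_pos b with rfl | hb
      · exact hx h
      · exact h3 hb.ne'
    have h6 : r = false → qPow q (N + e') (x + b + 1) = qPow q N (x + b + 1) := fun h => by
      rcases Nat.eq_zero_or_pos c with rfl | hc
      · exact hy h
      · exact h4 hc.ne'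
    generalize link rp x (N + e') = L' at *
    generalize link rp x N = L at *
    generalize link rp (x + b + c) (N + e') = R' at *
    generalize link rp (x + b + c) N = R at *
    have hb0 : ∀ v : ℕ → K, (if b = 0 then v x else v (x + b)) = v (x + b) := fun v => by
      split_ifs with h <;> simp [h]
    have hc0 : ∀ v : ℕ → K, (if c = 0 then v (x + b + c + 1) else v (x + b + 1)) =
        v (x + b + 1) := fun v => by
      split_ifs with h <;> simp [h]
    cases l <;> cases r <;>
      simp only [Bool.false_eq_true, if_false, if_true, Bool.not_true, Bool.not_false,
        Bool.and_true, Bool.and_false, mul_one, forall_const,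
        mul_zero, sub_zero, add_zero] at hl hr hx hy h5 h6 ⊢
    · have e1 := hc0 fun p => (qPow q N p)⁻¹
      have e2 := hc0 fun p => (qPow q (N + e') p)⁻¹
      have e3 := hb0 fun p => qPow q N p
      rw [e2, e3, hl, hr, hx, hy, h5, h6]
      ring
    · by_cases hc : c = 0
      · rw [if_pos hc, if_pos hc, hl, hr, hc]
        ring
      · rw [if_neg hc, if_neg hc, hl, hr, hx, h4 hc]
        ring
    · rw [← hl, hr, hy]
      by_cases hb : b = 0
      · rw [if_pos hb, if_pos hb]
        ring
      · rw [if_neg hb, if_neg hb, h3 hb]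
        ring
    · rw [← hl, hr]
      by_cases hb : b = 0 <;> by_cases hc : c = 0 <;> simp only [hb, hc, if_true, if_false] <;> ring

theorem zpow_peel {q : K} (hq : q ≠ 0) {e e' i j i' j' a b a' b' : ℤ}
    (h : e + i * a + j * b = e' + i' * a' + j' * b') :
    q ^ e * ((q ^ i) ^ a * (q ^ j) ^ b) = q ^ e' * ((q ^ i') ^ a' * (q ^ j') ^ b') := by
  simp only [← zpow_mul, ← zpow_add₀ hq, ← add_assoc, h]

/-- The four choices at the outer pair match the terms of `certStep` with those of `dualSum_succ`,
and each pair of terms is one application of `Cert.peel`. -/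
theorem cert_certSum {q : K} {rp : ℤ → K} (hq : q ≠ 0)
    (hrp : ∀ m : ℤ, rp m * (1 - q ^ m) = rp (m - 1)) (f a b c d x : ℕ) (l r : Bool)
    (hf : a + b + c + d ≤ f) :
    Cert q rp x (a + b + c + d) l r ((a + d : ℕ) : ℤ)
      (fun N => certSum (qPow q N) f a b c d l
        (if r then 0 else (qPow q N (x + (a + b + c + d) + 1))⁻¹) x)
      (fun N => dualSum (qPow q N) f a b c d r (if l then 0 else qPow q N x) x) := by
  induction f generalizing a b c d x l r with
  | zero =>
    obtain ⟨rfl, rfl, rfl, rfl⟩ : a = 0 ∧ b = 0 ∧ c = 0 ∧ d = 0 := by omega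
    exact cert_base hq hrp 0 0 0 x l r
  | succ f ih =>
    have step : ∀ a b c d, a + b + c + d + 1 ≤ f + 1 →
        Cert q rp x (a + 1 + b + c + d) l r ((a + 1 + d : ℕ) : ℤ)
          (fun N => certSum (qPow q N) (f + 1) (a + 1) b c d l
            (if r then 0 else (qPow q N (x + (a + 1 + b + c + d) + 1))⁻¹) x)
          (fun N => dualSum (qPow q N) (f + 1) (a + 1) b c d r
            (if l then 0 else qPow q N x) x) := by
      intro a b c d hf
      by_cases h0 : b = 0 ∧ c = 0 ∧ d = 0
      · obtain ⟨rfl, rfl, rfl⟩ := h0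
        refine (cert_full hq hrp x a l r).congr (by simp) (fun N => ?_) fun N => ?_
        · simp [certSum_succ, certStep, add_assoc]
        · rw [dualSum_full]
      · obtain ⟨m, hm⟩ : ∃ m, a + b + c + d = m + 1 := ⟨a + b + c + d - 1, by omega⟩
        have sub : ∀ a' b' c' d', a' + b' + c' + d' = m → ∀ l' r',
            Cert q rp (x + 1) m l' r' ((a' + d' : ℕ) : ℤ)
            (fun N => certSum (qPow q N) f a' b' c' d' l'
              (if r' then 0 else (qPow q N (x + m + 2))⁻¹) (x + 1))
            (fun N => dualSum (qPow q N) f a' b' c' d' r'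
              (if l' then 0 else qPow q N (x + 1)) (x + 1)) := by
          intro a' b' c' d' h l' r'
          have := ih a' b' c' d' (x + 1) l' r' (by omega)
          rw [h, show x + 1 + m + 1 = x + m + 2 by ring] at this
          exact this
        -- In the names, `i` means selected and `o` left out, the left position coming first. The
        -- first monomial is taken at the translated sequence, the second at the original one. Their
        -- exponents differ by the increment of i(i - 1) + j(j - 1) + (i - 1)j, where i and j are
        -- the entries at the outer pair.
        have coo := Cert.ite (0 < b ∧ 0 < c) fun h =>
          ((sub a (b - 1) (c - 1) (d + 1) (by omega) false false).peel hq hrp (x := x) (l := l)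
            (r := r) false false (fun i j => i ^ (1 : ℤ) * j ^ (2 : ℤ))
            (fun i j => i ^ (1 : ℤ) * j ^ (2 : ℤ))
            fun i j => zpow_peel hq (by simp [bit])).congr
              (s' := ((a + 1 + d : ℕ) : ℤ)) (by simp [bit]; ring) (fun _ => rfl) (fun _ => rfl)
        have cio := Cert.ite (0 < c) fun h =>
          ((sub a b (c - 1) d (by omega) true false).peel hq hrp (x := x) (l := l)
            (r := r) true false (fun i j => i ^ (0 : ℤ) * j ^ (2 : ℤ))
            (fun i j => i ^ (2 : ℤ) * j ^ (3 : ℤ))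
            fun i j => zpow_peel hq (by simp [bit]; ring)).congr
              (s' := ((a + 1 + d : ℕ) : ℤ)) (by simp [bit]; ring) (fun _ => rfl) (fun _ => rfl)
        have coi := Cert.ite (0 < b) fun h =>
          ((sub a (b - 1) c d (by omega) false true).peel hq hrp (x := x) (l := l)
            (r := r) false true (fun i j => i ^ (0 : ℤ) * j ^ (1 : ℤ))
            (fun i j => i ^ (1 : ℤ) * j ^ (3 : ℤ))
            fun i j => zpow_peel hq (by simp [bit]; ring)).congr
              (s' := ((a + 1 + d : ℕ) : ℤ)) (by simp [bit]; ring) (fun _ => rfl) (fun _ => rfl)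
        have cii := Cert.ite (0 < d) fun h =>
          ((sub a b c (d - 1) (by omega) true true).peel hq hrp (x := x) (l := l)
            (r := r) true true (fun i j => i ^ (-1 : ℤ) * j ^ (1 : ℤ))
            (fun i j => i ^ (2 : ℤ) * j ^ (4 : ℤ))
            fun i j => zpow_peel hq (by simp [bit]; ring)).congr
              (s' := ((a + 1 + d : ℕ) : ℤ)) (by simp [bit]; omega) (fun _ => rfl) (fun _ => rfl)
        rw [show a + 1 + b + c + d = m + 2 by omega]
        refine (((coo.add cio).add coi).add cii).congr rfl (fun N => ?_) fun N => ?_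
        · rw [certSum_succ, certStep, if_neg h0, hm, ← add_assoc x m 1, add_assoc (x + m) 1 1,
            ← add_assoc x m 2, add_assoc (x + m) 2 1, one_sub_ite_right]
          simp only [Bool.not_true, Bool.not_false, Bool.and_true, Bool.and_false, Bool.true_and,
            Bool.false_and, Bool.false_eq_true, if_false, if_true, one_mul, mul_one,
            zpow_neg, zpow_ofNat]
          generalize (if l = true then _ else (1 : K)) = A
          generalize (if (!r) = true then _ else (1 : K)) = B
          split_ifs <;> ring
        · rw [dualSum_succ _ _ _ _ _ _ _ _ _ h0 (qPow_ne_zero hq N (by omega))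
            (qPow_ne_zero hq N (by omega)), hm, ← add_assoc x m 1, add_assoc (x + m) 1 1,
            add_assoc (x + m) 1 2,
            mul_comm (if l = true then 0 else qPow q N x) (qPow q N (x + 1))⁻¹, one_sub_ite_left]
          simp only [Bool.not_true, Bool.not_false, Bool.and_true, Bool.and_false, Bool.true_and,
            Bool.false_and, Bool.false_eq_true, if_false, if_true, one_mul, mul_one, zpow_ofNat]
          generalize (if r = true then _ else (1 : K)) = A
          generalize (if (!l) = true then _ else (1 : K)) = B
          split_ifs <;> ring
    rcases a with _ | a
    · rcases d with _ | d
      · rw [show 0 + b + c + 0 = b + c by ring]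
        exact cert_base hq hrp (f + 1) b c x l r
      · simp only [certSum_zero_succ, dualSum_zero_succ]
        have := step 0 b c d (by omega)
        rw [show 0 + 1 + b + c + d = 0 + b + c + (d + 1) by ring] at this
        rw [show 0 + (d + 1) = 0 + 1 + d by ring]
        exact this
    · exact step a b c d (by omega)

end Weight

/-! ### Brackets: weighted sums over sequences of fixed sum. -/

section Bracket

variable {K : Type*} [Field K]

/-- The exponent of `q` in `weight`. -/
def weightExp : ℕ → ℕ → (ℕ → ℤ) → ℤ
  | _, 0, _ => 0
  | x, 1, N => 3 * (N (x + 1) * (N (x + 1) - 1)) / 2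
  | x, n + 2, N => N (x + 1) * (N (x + 1) - 1) + N (x + n + 2) * (N (x + n + 2) - 1)
        + (N (x + 1) - 1) * N (x + n + 2) + weightExp (x + 1) n N

theorem weight_eq {q : K} (hq : q ≠ 0) (rp : ℤ → K) (x n : ℕ) (N : ℕ → ℤ) :
    weight q rp x n N = (∏ p ∈ Finset.Ico x (x + n + 1), link rp p N) * q ^ weightExp x n N := by
  induction n using Nat.twoStepInduction generalizing x with
  | zero => simp [weight, weightExp]
  | one => simp [weight, weightExp, Finset.prod_Ico_succ_top]
  | more n ih _ =>
    rw [weight, weightExp, zpow_add₀ hq _ (weightExp (x + 1) n N), ih,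
      show x + (n + 2) + 1 = x + n + 2 + 1 by ring,
      Finset.prod_Ico_succ_top (b := x + n + 2) (by omega),
      Finset.prod_eq_prod_Ico_succ_bot (a := x) (by omega), show x + 1 + n + 1 = x + n + 2 by ring]
    ring

/-- The sequences of integers supported on the positions `1, …, k`, with sum `n`. -/
def seqs (k : ℕ) (n : ℤ) : Set (ℕ → ℤ) :=
  {N | N 0 = 0 ∧ (∀ p, k < p → N p = 0) ∧ ∑ p ∈ Finset.Ico 1 (k + 1), N p = n}

theorem le_of_weight_ne_zero {q : K} (hq : q ≠ 0) {rp : ℤ → K} (hneg : ∀ m < 0, rp m = 0)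
    {k : ℕ} {N : ℕ → ℤ} (h : weight q rp 0 k N ≠ 0) {p : ℕ} (hp : p ≠ 0) (hpk : p ≤ k) :
    N (p + 1) ≤ N p := by
  by_contra hlt
  refine h ?_
  rw [weight_eq hq, Finset.prod_eq_zero (i := p) (by simp; omega), zero_mul]
  rw [link, if_neg hp, hneg _ (by omega)]

theorem nonneg_of_weight_ne_zero {q : K} (hq : q ≠ 0) {rp : ℤ → K} (hneg : ∀ m < 0, rp m = 0)
    {k : ℕ} {n : ℤ} {N : ℕ → ℤ} (hN : N ∈ seqs k n) (h : weight q rp 0 k N ≠ 0) (p : ℕ) :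
    0 ≤ N p := by
  rcases Nat.eq_zero_or_pos p with rfl | hp
  · exact hN.1.ge
  · by_cases hpk : k < p
    · exact (hN.2.1 p hpk).ge
    · obtain ⟨j, hj⟩ : ∃ j, p + j = k + 1 := ⟨k + 1 - p, by omega⟩
      clear hpk
      induction j generalizing p with
      | zero => exact (hN.2.1 p (by omega)).ge
      | succ j ih =>
        exact (ih (p + 1) (by omega) (by omega)).trans
          (le_of_weight_ne_zero hq hneg h hp.ne' (by omega))

theorem le_sum_of_weight_ne_zero {q : K} (hq : q ≠ 0) {rp : ℤ → K} (hneg : ∀ m < 0, rp m = 0)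
    {k : ℕ} {n : ℤ} {N : ℕ → ℤ} (hN : N ∈ seqs k n) (h : weight q rp 0 k N ≠ 0) (p : ℕ) :
    N p ≤ n := by
  have h0 := nonneg_of_weight_ne_zero hq hneg hN h
  by_cases hp : p ∈ Finset.Ico 1 (k + 1)
  · rw [← hN.2.2]
    exact Finset.single_le_sum (f := N) (fun i _ => h0 i) hp
  · have h1 : N p = 0 := by
      rw [Finset.mem_Ico] at hp
      rcases Nat.eq_zero_or_pos p with rfl | hp'
      · exact hN.1
      · exact hN.2.1 p (by omega)
    rw [h1, ← hN.2.2]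
    exact Finset.sum_nonneg fun i _ => h0 i

theorem finite_weight {q : K} (hq : q ≠ 0) {rp : ℤ → K} (hneg : ∀ m < 0, rp m = 0)
    (k : ℕ) (n : ℤ) : {N | N ∈ seqs k n ∧ weight q rp 0 k N ≠ 0}.Finite := by
  refine Set.Finite.of_finite_image (f := fun (N : ℕ → ℤ) (i : Fin (k + 1)) => N i) ?_ ?_
  · refine (Set.Finite.pi fun _ : Fin (k + 1) => Set.finite_Icc (0 : ℤ) n).subset ?_
    rintro _ ⟨N, ⟨h1, h2⟩, rfl⟩ i -
    exact ⟨nonneg_of_weight_ne_zero hq hneg h1 h2 _, le_sum_of_weight_ne_zero hq hneg h1 h2 _⟩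
  · rintro N ⟨h1, -⟩ N' ⟨h2, -⟩ h
    funext p
    by_cases hp : k < p
    · rw [h1.2.1 p hp, h2.2.1 p hp]
    · exact congrFun h ⟨p, by omega⟩

/-- The weighted sum of `F` over the sequences with sum `n`. -/
noncomputable def bracket (q : K) (rp : ℤ → K) (k : ℕ) (n : ℤ) (F : (ℕ → ℤ) → K) : K :=
  ∑ᶠ N ∈ seqs k n, weight q rp 0 k N * F N

theorem bracket_congr {q : K} {rp : ℤ → K} {k : ℕ} {n : ℤ} {F G : (ℕ → ℤ) → K}
    (h : ∀ N ∈ seqs k n, F N = G N) : bracket q rp k n F = bracket q rp k n G :=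
  finsum_mem_congr rfl fun N hN => by rw [h N hN]

theorem bracket_add {q : K} (hq : q ≠ 0) {rp : ℤ → K} (hneg : ∀ m < 0, rp m = 0) (k : ℕ) (n : ℤ)
    (F G : (ℕ → ℤ) → K) :
    bracket q rp k n (fun N => F N + G N) = bracket q rp k n F + bracket q rp k n G := by
  have hf : ∀ F : (ℕ → ℤ) → K,
      (seqs k n ∩ Function.support fun N => weight q rp 0 k N * F N).Finite := fun F =>
    (finite_weight hq hneg k n).subset fun N hN => ⟨hN.1, left_ne_zero_of_mul hN.2⟩
  rw [bracket, bracket, bracket, ← finsum_mem_add_distrib' (hf F) (hf G)]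
  simp only [mul_add]

theorem bracket_mul_left {q : K} (hq : q ≠ 0) {rp : ℤ → K} (hneg : ∀ m < 0, rp m = 0) (k : ℕ)
    (n : ℤ) (c : K) (F : (ℕ → ℤ) → K) :
    bracket q rp k n (fun N => c * F N) = c * bracket q rp k n F := by
  have hf : (seqs k n ∩ Function.support fun N => weight q rp 0 k N * F N).Finite :=
    (finite_weight hq hneg k n).subset fun N hN => ⟨hN.1, left_ne_zero_of_mul hN.2⟩
  rw [bracket, bracket, ← AddMonoidHom.coe_mulLeft c, AddMonoidHom.map_finsum_mem' _ hf]
  simp only [AddMonoidHom.coe_mulLeft, mul_left_comm]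

/-- Translation by the subset is a bijection between the sequences of sum n - s and those of sum n.
This is why the sequences are not required to be decreasing: the weight vanishes by itself on the
others. -/
theorem Cert.bracket_eq {q : K} (hq : q ≠ 0) {rp : ℤ → K} (hneg : ∀ m < 0, rp m = 0) {k : ℕ}
    {s : ℤ} {A B : (ℕ → ℤ) → K} (h : Cert q rp 0 k false false s A B) (n : ℤ) :
    bracket q rp k n A = bracket q rp k (n - s) B := by
  induction h with
  | zero => simp [bracket]
  | add _ _ h1 h2 => rw [bracket_add hq hneg, bracket_add hq hneg, h1, h2]
  | @single A B e hs h =>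
    -- The certificate fixes e only on 1, …, k. Cutting it off outside keeps the support and gives
    -- the boundary values 0 that the flags `false` demand.
    set e' : ℕ → ℤ := fun p => if p ∈ Finset.Ico 1 (k + 1) then e p else 0 with he'
    have hs' : ∑ p ∈ Finset.Ico 1 (k + 1), e' p = s := by
      rw [← hs, zero_add, zero_add]
      exact Finset.sum_congr rfl fun p hp => if_pos hp
    have h0 : e' 0 = 0 := if_neg (by simp)
    have h1 : ∀ p, k < p → e' p = 0 := fun p hp => if_neg (by simp; omega)
    symm
    refine finsum_mem_eq_of_bijOn (fun N => N + e') ⟨?_, ?_, ?_⟩ ?_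
    · rintro N ⟨h2, h3, h4⟩
      refine ⟨by simp [h0, h2], fun p hp => by simp [h1 p hp, h3 p hp], ?_⟩
      simp [Finset.sum_add_distrib, h4, hs']
    · intro N _ N' _ h
      exact add_right_cancel h
    · rintro N ⟨h2, h3, h4⟩
      refine ⟨N - e', ⟨by simp [h0, h2], fun p hp => by simp [h1 p hp, h3 p hp], ?_⟩, by simp⟩
      simp [Finset.sum_sub_distrib, h4, hs']
    · intro N _
      exact (h N e' (fun p h2 h3 => if_pos (by simp; omega)) h0 (h1 _ (by omega))).symm

/-! ### The recursion satisfied by the brackets. -/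

/-- The product of the `u p` with `i < p ≤ k`. -/
def tailProd (u : ℕ → K) (k i : ℕ) : K := ∏ p ∈ Finset.Ico (i + 1) (k + 1), u p

theorem tailProd_eq (u : ℕ → K) {k i : ℕ} (h : i < k) :
    tailProd u k i = u (i + 1) * tailProd u k (i + 1) := by
  rw [tailProd, tailProd, Finset.prod_eq_prod_Ico_succ_bot (by omega)]

theorem tailProd_zero {q : K} (hq : q ≠ 0) {k : ℕ} {n : ℤ} {N : ℕ → ℤ} (hN : N ∈ seqs k n) :
    tailProd (qPow q N) k 0 = q ^ n := by
  rw [← hN.2.2, tailProd, zero_add]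
  have : ∀ s : Finset ℕ, q ^ ∑ p ∈ s, N p = ∏ p ∈ s, q ^ N p := fun s => by
    induction s using Finset.cons_induction with
    | empty => simp
    | cons a s ha ih => rw [Finset.sum_cons, Finset.prod_cons, zpow_add₀ hq, ih]
  rw [this]
  refine Finset.prod_congr rfl fun p hp => ?_
  rw [qPow, if_neg (by simp at hp; omega)]

theorem certSum_top {q : K} (hq : q ≠ 0) (a b c : ℕ) {n : ℤ} {N : ℕ → ℤ}
    (hN : N ∈ seqs (a + b + c) n) :
    certSum (qPow q N) (a + b + c) a b c 0 false (qPow q N (a + b + c + 1))⁻¹ 0 =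
      tailProd (qPow q N) (a + b + c) a * tailProd (qPow q N) (a + b + c) (a + b) *
        (1 - qPow q N a * (qPow q N (a + b + 1))⁻¹ - qPow q N (a + b) + qPow q N a) := by
  -- Since `N_{k+1} = 0`, the right boundary parameter is 1.
  have h1 : qPow q N (a + b + c + 1) = 1 := by
    rw [qPow, if_neg (by omega), hN.2.1 _ (by omega), zpow_zero]
  have h2 : (if c = 0 then (1 : K) else (qPow q N (a + b + 1))⁻¹) = (qPow q N (a + b + 1))⁻¹ := by
    split_ifs with h
    · subst h
      rw [add_zero] at h1
      rw [h1, inv_one]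
    · rfl
  rw [h1, inv_one, certSum_eq_certVal _ _ _ _ _ _ _ le_rfl
    fun p h _ => qPow_ne_zero hq N (by omega),
    certVal]
  simp only [zero_add, h2, mul_one, tailProd]

theorem dualSum_top {q : K} (hq : q ≠ 0) (a b c : ℕ) {n : ℤ} {N : ℕ → ℤ}
    (hN : N ∈ seqs (a + b + c) n) :
    dualSum (qPow q N) (a + b + c) a b c 0 false 0 0 =
      q ^ n * (tailProd (qPow q N) (a + b + c) b * tailProd (qPow q N) (a + b + c) (b + c) *
        (1 - qPow q N b * (qPow q N (b + c + 1))⁻¹)) := by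
  have hne : ∀ i j, 0 < i → ∏ p ∈ Finset.Ico i j, qPow q N p ≠ 0 := by
    intro i j h1
    rw [Finset.prod_ne_zero_iff]
    intro p hp
    rw [Finset.mem_Ico] at hp
    exact qPow_ne_zero hq N (by omega)
  have hr : ∀ p, 0 < p → p ≤ 0 + a + c + b → rev (qPow q N) 0 (a + b + c + 0) p ≠ 0 :=
    fun p h1 h2 => inv_ne_zero (qPow_ne_zero hq N (by omega))
  have h0 := tailProd_zero hq hN
  have e1 := Finset.prod_Ico_consecutive (qPow q N) (m := 1) (n := b + 1) (k := a + b + c + 1)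
    (by omega) (by omega)
  have e2 := Finset.prod_Ico_consecutive (qPow q N) (m := 1) (n := b + c + 1) (k := a + b + c + 1)
    (by omega) (by omega)
  have h3 : (if b = 0 then 0 else qPow q N b) = qPow q N b := by
    split_ifs with h
    · simp [h, qPow]
    · rfl
  rw [dualSum, certSum_eq_certVal _ _ _ _ _ _ _ (by omega) hr, certVal,
    prod_rev _ _ _ _ _ (by omega), prod_rev _ _ _ _ _ (by omega), rev, rev, inv_inv]
  rw [show 2 * 0 + (a + b + c + 0) + 2 - (0 + a + c + b + 1) = 1 by omega,
    show 2 * 0 + (a + b + c + 0) + 2 - (0 + a + 1) = b + c + 1 by omega,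
    show 2 * 0 + (a + b + c + 0) + 2 - (0 + a + c + 1) = b + 1 by omega,
    show 2 * 0 + (a + b + c + 0) + 1 - (0 + a) = b + c + 1 by omega,
    show 2 * 0 + (a + b + c + 0) + 1 - (0 + a + c + 1) = b by omega, h3]
  rw [tailProd, zero_add] at h0
  simp only [add_zero, zero_add, mul_zero, sub_zero, tailProd, ← h0]
  have n1 := hne 1 (b + 1) one_pos
  have n2 := hne 1 (b + c + 1) one_pos
  set Z := ∏ p ∈ Finset.Ico 1 (a + b + c + 1), qPow q N p
  rw [mul_comm (qPow q N b)]
  generalize 1 - (qPow q N (b + c + 1))⁻¹ * qPow q N b = F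
  -- Each Z is the full product q^n. Two of them turn the inverted initial products of the closed
  -- form into tail products, and the third is the factor q^n.
  rw [show Z ^ 3 = Z * Z * Z by ring]
  nth_rewrite 2 [← e1]
  nth_rewrite 1 [← e2]
  field_simp

/-- The bracket of `c_{ij} (1 - U_i / U_{j+1})`. -/
noncomputable def stepBracket (q : K) (rp : ℤ → K) (k : ℕ) (n : ℤ) (i j : ℕ) : K :=
  bracket q rp k n fun N => tailProd (qPow q N) k i * tailProd (qPow q N) k j *
    (1 - qPow q N i * (qPow q N (j + 1))⁻¹)

/-- This is the certificate for the a-element subsets of {1, …, k}, with both combinations evaluated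
in closed form. -/
theorem bracket_certSum {q : K} (hq : q ≠ 0) {rp : ℤ → K}
    (hrp : ∀ m : ℤ, rp m * (1 - q ^ m) = rp (m - 1)) (hneg : ∀ m < 0, rp m = 0)
    (a b c : ℕ) (n : ℤ) :
    bracket q rp (a + b + c) n (fun N => tailProd (qPow q N) (a + b + c) a *
        tailProd (qPow q N) (a + b + c) (a + b) *
        (1 - qPow q N a * (qPow q N (a + b + 1))⁻¹ - qPow q N (a + b) + qPow q N a)) =
      q ^ (n - a) * stepBracket q rp (a + b + c) (n - a) b (b + c) := by
  have h := (cert_certSum hq hrp (a + b + c) a b c 0 0 false false le_rfl).bracket_eq hq hneg n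
  simp only [add_zero, zero_add, Bool.false_eq_true, if_false] at h
  rw [← bracket_congr fun N hN => certSum_top hq a b c hN, h, stepBracket,
    ← bracket_mul_left hq hneg]
  refine bracket_congr fun N hN => ?_
  rw [← dualSum_top hq a b c hN]
  simp [qPow]

theorem stepBracket_self {q : K} (hq : q ≠ 0) {rp : ℤ → K}
    (hrp : ∀ m : ℤ, rp m * (1 - q ^ m) = rp (m - 1)) (hneg : ∀ m < 0, rp m = 0)
    {k i : ℕ} (hi : i ≤ k) (n : ℤ) :
    stepBracket q rp k n i i = q ^ (n - i) * stepBracket q rp k (n - i) 0 (k - i) := by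
  obtain ⟨c, rfl⟩ := Nat.exists_eq_add_of_le hi
  have := bracket_certSum hq hrp hneg i 0 c n
  simp only [add_zero, zero_add, sub_add_cancel] at this
  rw [Nat.add_sub_cancel_left, ← this]
  rfl

/-- Since `tailProd` at j is `U_{j+1}` times `tailProd` at j + 1, the four-term factor of
`bracket_certSum` splits as the difference of the integrands at j + 1 and at j. -/
theorem stepBracket_succ {q : K} (hq : q ≠ 0) {rp : ℤ → K}
    (hrp : ∀ m : ℤ, rp m * (1 - q ^ m) = rp (m - 1)) (hneg : ∀ m < 0, rp m = 0)
    {k i j : ℕ} (hij : i ≤ j) (hj : j < k) (n : ℤ) :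
    stepBracket q rp k n i (j + 1) = stepBracket q rp k n i j +
      q ^ (n - i) * stepBracket q rp k (n - i) (j + 1 - i) (k - i) := by
  obtain ⟨b, rfl⟩ := Nat.exists_eq_add_of_le hij
  obtain ⟨c, rfl⟩ := Nat.exists_eq_add_of_le hj
  have := bracket_certSum hq hrp hneg i (b + 1) c n
  rw [show i + b + 1 + c = i + (b + 1) + c by ring, show i + b + 1 - i = b + 1 by omega,
    show i + (b + 1) + c - i = b + 1 + c by omega, ← this, stepBracket, stepBracket,
    ← bracket_add hq hneg]
  refine bracket_congr fun N hN => ?_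
  rw [tailProd_eq (i := i + b) _ (by omega), ← add_assoc i b 1]
  have := qPow_ne_zero hq N (p := i + b + 1) (by omega)
  field_simp
  ring

/-- The partial sums of `stepBracket`. -/
noncomputable def sumBracket (q : K) (rp : ℤ → K) (k : ℕ) (n : ℤ) (s t : ℕ) : K :=
  ∑ i ∈ Finset.range (s + 1), stepBracket q rp k n i t

theorem stepBracket_eq {q : K} (hq : q ≠ 0) {rp : ℤ → K}
    (hrp : ∀ m : ℤ, rp m * (1 - q ^ m) = rp (m - 1)) (hneg : ∀ m < 0, rp m = 0)
    {k i j : ℕ} (hij : i ≤ j) (hj : j ≤ k) (n : ℤ) :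
    stepBracket q rp k n i j = q ^ (n - i) * sumBracket q rp k (n - i) (j - i) (k - i) := by
  induction j, hij using Nat.le_induction with
  | base => simp [stepBracket_self hq hrp hneg hj, sumBracket]
  | succ j hij ih =>
    rw [stepBracket_succ hq hrp hneg hij hj, ih (by omega), sumBracket, sumBracket,
      show j + 1 - i = j - i + 1 by omega, Finset.sum_range_succ _ (j - i + 1), mul_add]

theorem sumBracket_zero {q : K} (hq : q ≠ 0) {rp : ℤ → K}
    (hrp : ∀ m : ℤ, rp m * (1 - q ^ m) = rp (m - 1)) (hneg : ∀ m < 0, rp m = 0)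
    {k t : ℕ} (ht : t ≤ k) (n : ℤ) :
    sumBracket q rp k n 0 t = q ^ n * sumBracket q rp k n t k := by
  have := stepBracket_eq hq hrp hneg (Nat.zero_le t) ht n
  rw [sumBracket, zero_add, Finset.sum_range_one, this]
  simp

theorem sumBracket_succ {q : K} (hq : q ≠ 0) {rp : ℤ → K}
    (hrp : ∀ m : ℤ, rp m * (1 - q ^ m) = rp (m - 1)) (hneg : ∀ m < 0, rp m = 0)
    {k s t : ℕ} (hs : s < t) (ht : t ≤ k) (n : ℤ) :
    sumBracket q rp k n (s + 1) t = sumBracket q rp k n s t + q ^ (n - (s + 1 : ℕ)) *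
      sumBracket q rp k (n - (s + 1 : ℕ)) (t - (s + 1)) (k - (s + 1)) := by
  rw [sumBracket, Finset.sum_range_succ, ← sumBracket, stepBracket_eq hq hrp hneg hs ht]

theorem bracket_of_neg {q : K} (hq : q ≠ 0) {rp : ℤ → K} (hneg : ∀ m < 0, rp m = 0) (k : ℕ)
    {n : ℤ} (hn : n < 0) (F : (ℕ → ℤ) → K) : bracket q rp k n F = 0 := by
  refine finsum_mem_eq_zero_of_forall_eq_zero fun N hN => ?_
  by_contra h
  have h0 := left_ne_zero_of_mul h
  have h1 := nonneg_of_weight_ne_zero hq hneg hN h0 0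
  have h2 := le_sum_of_weight_ne_zero hq hneg hN h0 0
  omega

theorem sumBracket_of_neg {q : K} (hq : q ≠ 0) {rp : ℤ → K} (hneg : ∀ m < 0, rp m = 0) (k : ℕ)
    {n : ℤ} (hn : n < 0) (s t : ℕ) : sumBracket q rp k n s t = 0 :=
  Finset.sum_eq_zero fun _ _ => bracket_of_neg hq hneg k hn _

theorem sumBracket_zero_top {q : K} (hq : q ≠ 0) {rp : ℤ → K} (hneg : ∀ m < 0, rp m = 0)
    (k : ℕ) (n : ℤ) :
    sumBracket q rp k n 0 k = q ^ n * bracket q rp k n fun _ => 1 := by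
  rw [sumBracket, zero_add, Finset.sum_range_one, stepBracket, ← bracket_mul_left hq hneg]
  refine bracket_congr fun N hN => ?_
  rw [tailProd_zero hq hN]
  simp [tailProd, qPow]

/-- The recursion that `sumBracket` satisfies has a unique solution. -/
theorem recursion_unique {q : K} (hq : ∀ n : ℕ, n ≠ 0 → q ^ n ≠ 1) {k : ℕ}
    {X Y : ℕ → ℕ → ℕ → K} (h0 : X 0 0 k = Y 0 0 k)
    (hX : ∀ n t, t ≤ k → X n 0 t = q ^ n * X n t k) (hY : ∀ n t, t ≤ k → Y n 0 t = q ^ n * Y n t k)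
    (hX' : ∀ n s t, s < t → t ≤ k → X n (s + 1) t = X n s t +
      if s + 1 ≤ n then q ^ (n - (s + 1)) * X (n - (s + 1)) (t - (s + 1)) (k - (s + 1)) else 0)
    (hY' : ∀ n s t, s < t → t ≤ k → Y n (s + 1) t = Y n s t +
      if s + 1 ≤ n then q ^ (n - (s + 1)) * Y (n - (s + 1)) (t - (s + 1)) (k - (s + 1)) else 0)
    (n s t : ℕ) (hs : s ≤ t) (ht : t ≤ k) : X n s t = Y n s t := by
  induction n using Nat.strong_induction_on generalizing s t with
  | _ n ih =>
    -- The difference X - Y does not depend on s, because each increment in s involves only a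
    -- smaller n.
    have h1 : ∀ s t, s ≤ t → t ≤ k → X n s t - Y n s t = X n 0 t - Y n 0 t := by
      intro s t hs ht
      induction s with
      | zero => rfl
      | succ s ihs =>
        rw [hX' n s t hs ht, hY' n s t hs ht, ← ihs (by omega)]
        split_ifs with h
        · rw [ih (n - (s + 1)) (by omega) _ _ (by omega) (by omega)]
          ring
        · ring
    -- Independence of s replaces the index (t, k) by (0, k). At t = k this gives D = q^n D, where D
    -- is the difference at (0, k).
    have h2 : ∀ t, t ≤ k → X n 0 t - Y n 0 t = q ^ n * (X n 0 k - Y n 0 k) := by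
      intro t ht
      rw [hX n t ht, hY n t ht, ← mul_sub, h1 t k ht le_rfl]
    have h3 : X n 0 k - Y n 0 k = 0 := by
      rcases eq_or_ne n 0 with rfl | hn
      · rw [h0, sub_self]
      · have h4 := h2 k le_rfl
        have h5 : (1 - q ^ n) * (X n 0 k - Y n 0 k) = 0 := by linear_combination h4
        exact (mul_eq_zero.1 h5).resolve_left (sub_ne_zero.2 (hq n hn).symm)
    exact sub_eq_zero.1 (by rw [h1 s t hs ht, h2 t ht, h3, mul_zero])

end Bracket

/-! ### The recursion for configurations, obtained by deleting the first entry. -/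

section Configurations

/-- The number of particles of a configuration. -/
def size (a : ℕ →₀ ℕ) : ℕ := a.sum fun _ m => m

/-- The configurations of size `n` and degree `d` with `a_0 ≤ s` and `a_0 + a_1 ≤ t`. -/
def boundedConfigs (k n s t d : ℕ) : Set (ℕ →₀ ℕ) :=
  {a | a ∈ configurations k ∧ size a = n ∧ degree a = d ∧ a 0 ≤ s ∧ a 0 + a 1 ≤ t}

/-- The sequence `(m, b_0, b_1, …)`. -/
noncomputable def prepend (m : ℕ) (b : ℕ →₀ ℕ) : ℕ →₀ ℕ :=
  Finsupp.single 0 m + b.mapDomain Nat.succ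

@[simp] theorem prepend_zero (m : ℕ) (b : ℕ →₀ ℕ) : prepend m b 0 = m := by
  rw [prepend, Finsupp.add_apply, Finsupp.mapDomain_of_notMem_range _ _ (by simp)]
  simp

@[simp] theorem prepend_succ (m : ℕ) (b : ℕ →₀ ℕ) (i : ℕ) : prepend m b (i + 1) = b i := by
  rw [prepend, Finsupp.add_apply, ← Nat.succ_eq_add_one,
    Finsupp.mapDomain_apply Nat.succ_injective]
  simp

theorem prepend_one (m : ℕ) (b : ℕ →₀ ℕ) : prepend m b 1 = b 0 := prepend_succ m b 0

theorem prepend_injective (m : ℕ) : Function.Injective (prepend m) := fun b b' h => by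
  ext i
  simpa using DFunLike.congr_fun h (i + 1)

theorem exists_eq_prepend (a : ℕ →₀ ℕ) : ∃ b, a = prepend (a 0) b :=
  ⟨a.comapDomain Nat.succ Nat.succ_injective.injOn, by
    ext i
    cases i <;> simp⟩

theorem size_prepend (m : ℕ) (b : ℕ →₀ ℕ) : size (prepend m b) = m + size b := by
  rw [size, prepend, Finsupp.sum_add_index' (by simp) (by simp),
    Finsupp.sum_mapDomain_index (by simp) (by simp)]
  simp [size]

theorem degree_prepend (m : ℕ) (b : ℕ →₀ ℕ) : degree (prepend m b) = degree b + size b := by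
  rw [degree, prepend, Finsupp.sum_add_index' (by simp) (fun _ _ _ => mul_add _ _ _),
    Finsupp.sum_mapDomain_index (by simp) (fun _ _ _ => mul_add _ _ _)]
  simp [degree, size, Nat.succ_mul, Finsupp.sum_add]

theorem prepend_mem_configurations {k m : ℕ} {b : ℕ →₀ ℕ} :
    prepend m b ∈ configurations k ↔ b ∈ configurations k ∧ m + b 0 + b 1 ≤ k := by
  constructor
  · intro h
    exact ⟨fun i => by simpa using h (i + 1), by simpa using h 0⟩
  · rintro ⟨h1, h2⟩ i
    cases i with
    | zero => simpa using h2
    | succ i => simpa using h1 i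

theorem finite_boundedConfigs (k n s t d : ℕ) : (boundedConfigs k n s t d).Finite := by
  refine ((Finset.range (d + 1)).finsuppAntidiag n).finite_toSet.subset ?_
  rintro a ⟨-, h1, h2, -, -⟩
  have hs : a.support ⊆ Finset.range (d + 1) := fun i hi => by
    rw [Finset.mem_range, Nat.lt_succ_iff, ← h2]
    exact (Nat.le_mul_of_pos_right i (Nat.pos_of_ne_zero (Finsupp.mem_support_iff.1 hi))).trans
      (Finset.single_le_sum (f := fun i => i * a i) (fun _ _ => Nat.zero_le _) hi)
  rw [Finset.mem_coe, Finset.mem_finsuppAntidiag]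
  exact ⟨by rw [← h1, size, Finsupp.sum_of_support_subset a hs _ (by simp)], hs⟩

/-- Deleting `a_0 = m` turns `a_0 + a_1 ≤ t` into a bound on the new first entry, and the window
condition at 0 into a bound on the new first two. Each of the n - m remaining particles moves one
place to the left, which lowers the degree by n - m. -/
theorem boundedConfigs_slice {k n t d m : ℕ} (hm : m ≤ n) (hd : n - m ≤ d) (ht : m ≤ t)
    (hk : m ≤ k) :
    {a ∈ boundedConfigs k n m t d | a 0 = m} =
      prepend m '' boundedConfigs k (n - m) (t - m) (k - m) (d - (n - m)) := by
  ext a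
  constructor
  · rintro ⟨⟨h1, h2, h3, -, h4⟩, h5⟩
    obtain ⟨b, hb⟩ := exists_eq_prepend a
    rw [h5] at hb
    subst hb
    rw [prepend_mem_configurations] at h1
    rw [size_prepend] at h2
    rw [degree_prepend] at h3
    rw [prepend_zero, prepend_one] at h4
    exact ⟨b, ⟨h1.1, by omega, by omega, by omega, by omega⟩, rfl⟩
  · rintro ⟨b, ⟨h1, h2, h3, h4, h5⟩, rfl⟩
    refine ⟨⟨prepend_mem_configurations.2 ⟨h1, by omega⟩, ?_, ?_, ?_, ?_⟩, ?_⟩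
    · rw [size_prepend]; omega
    · rw [degree_prepend]; omega
    · simp
    · rw [prepend_zero, prepend_one]; omega
    · simp

theorem boundedConfigs_slice_eq_empty {k n t d m : ℕ} (h : ¬ (m ≤ n ∧ n - m ≤ d)) :
    {a ∈ boundedConfigs k n m t d | a 0 = m} = ∅ := by
  rw [Set.eq_empty_iff_forall_notMem]
  rintro a ⟨⟨-, h2, h3, -, -⟩, h5⟩
  obtain ⟨b, hb⟩ := exists_eq_prepend a
  rw [hb, h5, size_prepend] at h2
  rw [hb, degree_prepend] at h3
  omega

/-- The generating function of the configurations of size `n` with `a_0 ≤ s`, `a_0 + a_1 ≤ t`. -/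
noncomputable def configSeries (k n s t : ℕ) : ℤ⟦X⟧ :=
  PowerSeries.mk fun d => ((boundedConfigs k n s t d).ncard : ℤ)

theorem ncard_slice {k n t d m : ℕ} (ht : m ≤ t) (hk : m ≤ k) :
    (({a ∈ boundedConfigs k n m t d | a 0 = m}).ncard : ℤ) =
      PowerSeries.coeff d (if m ≤ n then
        PowerSeries.X ^ (n - m) * configSeries k (n - m) (t - m) (k - m) else 0) := by
  split_ifs with hm
  · rw [PowerSeries.coeff_X_pow_mul']
    split_ifs with hd
    · rw [boundedConfigs_slice hm hd ht hk, Set.ncard_image_of_injective _ (prepend_injective m),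
        configSeries, PowerSeries.coeff_mk]
    · rw [boundedConfigs_slice_eq_empty (by tauto)]
      simp
  · rw [boundedConfigs_slice_eq_empty (by tauto)]
    simp

theorem configSeries_zero (k n t : ℕ) :
    configSeries k n 0 t = PowerSeries.X ^ n * configSeries k n t k := by
  ext d
  have := ncard_slice (k := k) (n := n) (t := t) (d := d) (Nat.zero_le t) (Nat.zero_le k)
  simp only [Nat.zero_le, if_true, Nat.sub_zero] at this
  rw [← this, configSeries, PowerSeries.coeff_mk]
  congr 2
  ext a
  exact ⟨fun h => ⟨h, Nat.le_zero.1 h.2.2.2.1⟩, fun h => h.1⟩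

theorem configSeries_succ {k s t : ℕ} (n : ℕ) (hs : s < t) (ht : t ≤ k) :
    configSeries k n (s + 1) t = configSeries k n s t + if s + 1 ≤ n then
      PowerSeries.X ^ (n - (s + 1)) * configSeries k (n - (s + 1)) (t - (s + 1)) (k - (s + 1))
      else 0 := by
  ext d
  rw [map_add, ← ncard_slice hs (hs.trans_le ht), configSeries, configSeries, PowerSeries.coeff_mk,
    PowerSeries.coeff_mk, ← Nat.cast_add, ← Set.ncard_union_eq _ (finite_boundedConfigs _ _ _ _ _)
      ((finite_boundedConfigs k n (s + 1) t d).subset fun a h => h.1)]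
  · congr 2
    ext a
    constructor
    · rintro ⟨h1, h2, h3, h4, h5⟩
      rcases Nat.lt_or_ge (a 0) (s + 1) with h | h
      · exact Or.inl ⟨h1, h2, h3, by omega, h5⟩
      · exact Or.inr ⟨⟨h1, h2, h3, h4, h5⟩, by omega⟩
    · rintro (⟨h1, h2, h3, h4, h5⟩ | h)
      · exact ⟨h1, h2, h3, by omega, h5⟩
      · exact h.1
  · rw [Set.disjoint_left]
    rintro a ⟨-, -, -, h4, -⟩ ⟨-, h⟩
    omega

theorem configSeries_zero_zero (k s t : ℕ) : configSeries k 0 s t = 1 := by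
  have h0 : ∀ a : ℕ →₀ ℕ, size a = 0 → a = 0 := by
    intro a ha
    ext i
    have := (Finset.sum_eq_zero_iff.1 ha) i
    by_contra h
    exact h (this (Finsupp.mem_support_iff.2 h))
  ext d
  rw [configSeries, PowerSeries.coeff_mk, PowerSeries.coeff_one]
  split_ifs with hd
  · rw [Nat.cast_eq_one, Set.ncard_eq_one]
    refine ⟨0, Set.eq_singleton_iff_unique_mem.2 ⟨⟨?_, ?_, ?_, ?_, ?_⟩, fun a h => h0 a h.2.1⟩⟩
    all_goals simp [configurations, size, degree, hd]
  · rw [Nat.cast_eq_zero, Set.ncard_eq_zero (finite_boundedConfigs _ _ _ _ _),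
      Set.eq_empty_iff_forall_notMem]
    rintro a ⟨-, h1, h2, -, -⟩
    rw [h0 a h1] at h2
    exact hd (h2.symm.trans (by simp [degree]))

end Configurations

/-! ### Conjugate partitions and the quadratic form. -/

section Partitions

/-- Doubling symmetrises the pairing of p with its mirror image p': for p < p' the cross term `(N p
- 1) * N p'` is `N p * N p' - N (max p p')`, counted once from each end. An unpaired middle position
contributes its single term. -/
theorem two_mul_weightExp (x n : ℕ) (N : ℕ → ℤ) :
    2 * weightExp x n N = ∑ p ∈ Finset.Ico (x + 1) (x + n + 1),
      (2 * (N p * (N p - 1)) + N p * N (2 * x + n + 1 - p) - N (max p (2 * x + n + 1 - p))) := by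
  induction n using Nat.twoStepInduction generalizing x with
  | zero => simp [weightExp]
  | one =>
    have h : 2 ∣ 3 * (N (x + 1) * (N (x + 1) - 1)) :=
      (Int.even_mul_pred_self (N (x + 1))).two_dvd.mul_left 3
    rw [weightExp, Int.mul_ediv_cancel' h, Finset.sum_Ico_succ_top (by omega), Finset.Ico_self,
      Finset.sum_empty, show 2 * x + 1 + 1 - (x + 1) = x + 1 by omega, max_self]
    ring
  | more n ih _ =>
    rw [weightExp, mul_add, ih, show x + (n + 2) + 1 = x + n + 2 + 1 by ring,
      Finset.sum_Ico_succ_top (b := x + n + 2) (by omega),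
      Finset.sum_eq_sum_Ico_succ_bot (a := x + 1) (by omega),
      show 2 * x + (n + 2) + 1 - (x + 1) = x + n + 2 by omega,
      show 2 * x + (n + 2) + 1 - (x + n + 2) = x + 1 by omega,
      max_eq_right (by omega : x + 1 ≤ x + n + 2), max_eq_left (by omega : x + 1 ≤ x + n + 2),
      show 2 * (x + 1) + n + 1 = 2 * x + (n + 2) + 1 by ring,
      show x + 1 + n + 1 = x + n + 2 by ring]
    ring

/-- The conjugate of the partition with `m l` parts equal to `l + 1`. -/
def conjugate {k : ℕ} (m : Fin k → ℕ) (p : ℕ) : ℤ :=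
  if p = 0 then 0 else ∑ l : Fin k, (if p ≤ l + 1 then 1 else 0) * (m l : ℤ)

theorem sum_ite_le_min {k L L' : ℕ} (h : L ≤ k) :
    ∑ p ∈ Finset.Ico 1 (k + 1), ((if p ≤ L then 1 else 0) * (if p ≤ L' then 1 else 0) : ℤ) =
      (min L L' : ℕ) := by
  have : (Finset.Ico 1 (k + 1)).filter (fun p => p ≤ L ∧ p ≤ L') = Finset.Icc 1 (min L L') := by
    ext p
    simp
    omega
  simp only [ite_zero_mul_ite_zero, mul_one]
  rw [Finset.sum_boole, this]
  simp

theorem sum_ite_le_reflect {k L L' : ℕ} (h : L ≤ k) (h' : L' ≤ k) :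
    ∑ p ∈ Finset.Ico 1 (k + 1),
      ((if p ≤ L then 1 else 0) * (if k + 1 - p ≤ L' then 1 else 0) : ℤ) =
      (L + L' - k : ℕ) := by
  have : (Finset.Ico 1 (k + 1)).filter (fun p => p ≤ L ∧ k + 1 - p ≤ L') =
      Finset.Icc (k + 1 - L') L := by
    ext p
    simp
    omega
  simp only [ite_zero_mul_ite_zero, mul_one]
  rw [Finset.sum_boole, this, Nat.card_Icc]
  congr 1
  omega

/-- Here min(l, l') counts the p with p ≤ l and p ≤ l', while max(l + l' - k, 0) counts the p ≤ l
whose mirror image k + 1 - p is at most l'. -/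
theorem A_eq_sum {k : ℕ} (i j : Fin k) :
    (A k i j : ℤ) = ∑ p ∈ Finset.Ico 1 (k + 1),
      (2 * ((if p ≤ (i : ℕ) + 1 then 1 else 0) * (if p ≤ (j : ℕ) + 1 then 1 else 0)) +
        (if p ≤ (i : ℕ) + 1 then 1 else 0) * (if k + 1 - p ≤ (j : ℕ) + 1 then 1 else 0)) := by
  rw [Finset.sum_add_distrib, ← Finset.mul_sum, sum_ite_le_min (by omega),
    sum_ite_le_reflect (by omega) (by omega), A, Matrix.of_apply]
  push_cast
  rfl

theorem conjugate_mul {k : ℕ} (m : Fin k → ℕ) {p p' : ℕ} (hp : p ≠ 0) (hp' : p' ≠ 0) :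
    conjugate m p * conjugate m p' = ∑ i : Fin k, ∑ j : Fin k,
      ((if p ≤ (i : ℕ) + 1 then 1 else 0) * (if p' ≤ (j : ℕ) + 1 then 1 else 0)) *
        (m j : ℤ) * (m i : ℤ) := by
  rw [conjugate, conjugate, if_neg hp, if_neg hp', Finset.sum_mul_sum]
  refine Finset.sum_congr rfl fun i _ => Finset.sum_congr rfl fun j _ => ?_
  ring

theorem two_mul_Q {k : ℕ} (m : Fin k → ℕ) :
    2 * (Q k m : ℤ) = (((A k).mulVec m) ⬝ᵥ m : ℕ) - (∑ l, A k l l * m l : ℕ) := by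
  have h : 2 * (Q k m : ℚ) = (((A k).mulVec m) ⬝ᵥ m : ℕ) - (∑ l, A k l l * m l : ℕ) := by
    rw [Q_eq]; ring
  exact_mod_cast h

/-- Inserting the counting formula `A_eq_sum` makes the quadratic part a sum of products of entries
of the conjugate. The diagonal part is linear, as p ≤ l and k + 1 - p ≤ l together say max(p, k + 1
- p) ≤ l. -/
theorem weightExp_conjugate {k : ℕ} (m : Fin k → ℕ) :
    weightExp 0 k (conjugate m) = Q k m := by
  have h1 : ((((A k).mulVec m) ⬝ᵥ m : ℕ) : ℤ) = ∑ p ∈ Finset.Ico 1 (k + 1),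
      (2 * (conjugate m p * conjugate m p) + conjugate m p * conjugate m (k + 1 - p)) := by
    simp only [dotProduct, Matrix.mulVec, Nat.cast_sum, Nat.cast_mul, A_eq_sum, Finset.sum_mul]
    rw [Finset.sum_congr rfl fun i _ => Finset.sum_comm, Finset.sum_comm]
    refine Finset.sum_congr rfl fun p hp => ?_
    rw [Finset.mem_Ico] at hp
    rw [conjugate_mul m (by omega) (by omega), conjugate_mul m (by omega) (by omega)]
    simp only [Finset.mul_sum, ← Finset.sum_add_distrib]
    refine Finset.sum_congr rfl fun i _ => Finset.sum_congr rfl fun j _ => ?_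
    ring
  have h2 : ((∑ l, A k l l * m l : ℕ) : ℤ) = ∑ p ∈ Finset.Ico 1 (k + 1),
      (2 * conjugate m p + conjugate m (max p (k + 1 - p))) := by
    simp only [Nat.cast_sum, Nat.cast_mul, A_eq_sum, Finset.sum_mul]
    rw [Finset.sum_comm]
    refine Finset.sum_congr rfl fun p hp => ?_
    rw [Finset.mem_Ico] at hp
    rw [conjugate, conjugate, if_neg (by omega), if_neg (by omega), Finset.mul_sum,
      ← Finset.sum_add_distrib]
    refine Finset.sum_congr rfl fun i _ => ?_
    simp only [ite_zero_mul_ite_zero, mul_one, and_self, max_le_iff]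
    ring
  have h3 := two_mul_weightExp 0 k (conjugate m)
  simp only [mul_zero, zero_add] at h3
  refine mul_left_cancel₀ (two_ne_zero (α := ℤ)) ?_
  rw [h3, two_mul_Q, h1, h2, ← Finset.sum_sub_distrib]
  refine Finset.sum_congr rfl fun p _ => ?_
  ring

theorem conjugate_sub {k : ℕ} (m : Fin k → ℕ) (l : Fin k) :
    conjugate m (l + 1) - conjugate m (l + 1 + 1) = m l := by
  rw [conjugate, conjugate, if_neg (by omega), if_neg (by omega), ← Finset.sum_sub_distrib,
    Finset.sum_eq_single l]
  · simp
  · intro j _ hj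
    have : (j : ℕ) ≠ l := fun h => hj (Fin.ext h)
    by_cases h : (l : ℕ) ≤ j
    · rw [if_pos (by omega), if_pos (by omega), sub_self]
    · rw [if_neg (by omega), if_neg (by omega), sub_self]
  · simp

theorem conjugate_injective (k : ℕ) : Function.Injective (conjugate (k := k)) := fun m m' h => by
  ext l
  have := conjugate_sub m l
  rw [h, conjugate_sub m' l] at this
  exact_mod_cast this.symm

/-- The size of the partition with `m l` parts equal to `l + 1`. -/
def partitionSize {k : ℕ} (m : Fin k → ℕ) : ℕ := ∑ l : Fin k, ((l : ℕ) + 1) * m l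

theorem conjugate_mem_seqs {k : ℕ} (m : Fin k → ℕ) : conjugate m ∈ seqs k (partitionSize m) := by
  refine ⟨if_pos rfl, fun p hp => ?_, ?_⟩
  · rw [conjugate, if_neg (by omega)]
    refine Finset.sum_eq_zero fun l _ => ?_
    rw [if_neg (by omega), zero_mul]
  · have : ∀ p ∈ Finset.Ico 1 (k + 1), conjugate m p =
        ∑ l : Fin k, (if p ≤ (l : ℕ) + 1 then 1 else 0) * (m l : ℤ) := fun p hp =>
      if_neg (by simp at hp; omega)
    rw [Finset.sum_congr rfl this, Finset.sum_comm, partitionSize, Nat.cast_sum]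
    refine Finset.sum_congr rfl fun l _ => ?_
    have h := sum_ite_le_min (k := k) (L := (l : ℕ) + 1) (L' := (l : ℕ) + 1) (by omega)
    simp only [ite_zero_mul_ite_zero, mul_one, and_self, min_self] at h
    rw [← Finset.sum_mul, h, Nat.cast_mul]

/-- The multiplicities are the successive differences of N. Agreement is propagated downwards from
position k + 1, where both sequences vanish. -/
theorem exists_eq_conjugate {k : ℕ} {n : ℤ} {N : ℕ → ℤ} (hN : N ∈ seqs k n)
    (h : ∀ p, p ≠ 0 → p ≤ k → N (p + 1) ≤ N p) : ∃ m : Fin k → ℕ, conjugate m = N := by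
  refine ⟨fun l => (N (l + 1) - N (l + 1 + 1)).toNat, ?_⟩
  set m : Fin k → ℕ := fun l => (N (l + 1) - N (l + 1 + 1)).toNat with hm
  have hc := conjugate_mem_seqs m
  have key : ∀ j p, p ≠ 0 → p + j = k + 1 → conjugate m p = N p := by
    intro j
    induction j with
    | zero => intro p _ hp; rw [hc.2.1 p (by omega), hN.2.1 p (by omega)]
    | succ j ih =>
      intro p hp0 hp
      obtain ⟨p, rfl⟩ := Nat.exists_eq_succ_of_ne_zero hp0
      have h1 := conjugate_sub m ⟨p, by omega⟩
      have h2 := h (p + 1) (by omega) (by omega)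
      have h3 := ih (p + 1 + 1) (by omega) (by omega)
      simp only [hm, Int.toNat_of_nonneg (sub_nonneg.2 h2)] at h1
      rw [Nat.succ_eq_add_one]
      simp only [← hm] at h1
      omega
  funext p
  rcases Nat.eq_zero_or_pos p with rfl | hp
  · rw [hc.1, hN.1]
  · by_cases hpk : k < p
    · rw [hc.2.1 p hpk, hN.2.1 p hpk]
    · exact key (k + 1 - p) p hp.ne' (by omega)

theorem weight_conjugate {K : Type*} [Field K] {q : K} (hq : q ≠ 0) (rp : ℤ → K) {k : ℕ}
    (m : Fin k → ℕ) :
    weight q rp 0 k (conjugate m) = q ^ Q k m * ∏ l, rp (m l) := by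
  rw [weight_eq hq, weightExp_conjugate, zpow_natCast, mul_comm, ← Finset.range_eq_Ico, zero_add,
    Finset.prod_range_succ', link, if_pos rfl, mul_one, Finset.prod_range]
  congr 1
  refine Finset.prod_congr rfl fun l _ => ?_
  rw [link, if_neg (by omega), conjugate_sub]

theorem bracket_one {K : Type*} [Field K] {q : K} (hq : q ≠ 0) {rp : ℤ → K}
    (hneg : ∀ m < 0, rp m = 0) (k n : ℕ) :
    bracket q rp k n (fun _ => 1) =
      ∑ᶠ m ∈ {m : Fin k → ℕ | partitionSize m = n}, q ^ Q k m * ∏ l, rp (m l) := by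
  have : seqs k n ∩ (Function.support fun N => weight q rp 0 k N * 1) =
      (conjugate '' {m : Fin k → ℕ | partitionSize m = n}) ∩
        (Function.support fun N => weight q rp 0 k N * 1) := by
    ext N
    constructor
    · rintro ⟨h1, h2⟩
      refine ⟨?_, h2⟩
      obtain ⟨m, rfl⟩ := exists_eq_conjugate h1
        fun p hp hpk => le_of_weight_ne_zero hq hneg (left_ne_zero_of_mul h2) hp hpk
      refine ⟨m, ?_, rfl⟩
      have := (conjugate_mem_seqs m).2.2.symm.trans h1.2.2
      exact_mod_cast this
    · rintro ⟨⟨m, rfl, rfl⟩, h2⟩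
      exact ⟨conjugate_mem_seqs m, h2⟩
  rw [bracket, finsum_mem_inter_support_eq _ _ _ this,
    finsum_mem_image (conjugate_injective k).injOn]
  simp only [weight_conjugate hq, mul_one]

theorem finite_partitionSize (k n : ℕ) : {m : Fin k → ℕ | partitionSize m = n}.Finite := by
  refine (Set.Finite.pi fun _ : Fin k => Set.finite_Iic n).subset ?_
  rintro m rfl l -
  exact (Nat.le_mul_of_pos_left (m l) (Nat.succ_pos l)).trans
    (Finset.single_le_sum (f := fun l : Fin k => ((l : ℕ) + 1) * m l)
      (fun _ _ => Nat.zero_le _) (Finset.mem_univ l))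

end Partitions

/-! ### The identity for a fixed number of particles. -/

section Identity

theorem qPochInv_succ_mul (n : ℕ) :
    qPochInv (n + 1) * (1 - PowerSeries.X ^ (n + 1)) = qPochInv n := by
  have h1 := qPoch_mul_qPochInv n
  have h2 := qPoch_mul_qPochInv (n + 1)
  rw [qPoch, Finset.prod_range_succ, ← qPoch] at h2
  calc _ = qPochInv (n + 1) * (1 - PowerSeries.X ^ (n + 1)) * (qPoch n * qPochInv n) := by
        rw [h1, mul_one]
    _ = (qPoch n * (1 - PowerSeries.X ^ (n + 1)) * qPochInv (n + 1)) * qPochInv n := by ring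
    _ = qPochInv n := by rw [h2, one_mul]

/-- `1 / (q)_m`, extended by `0` to negative `m`, in the fraction field. -/
noncomputable def fracPochInv (m : ℤ) : FractionRing ℤ⟦X⟧ :=
  if 0 ≤ m then algebraMap ℤ⟦X⟧ _ (qPochInv m.toNat) else 0

/-- At m = 0 the factor 1 - q^0 vanishes, in accordance with the value 0 at -1. The recurrence thus
holds for all integers, as translations of arbitrary integer sequences require. -/
theorem fracPochInv_mul (m : ℤ) :
    fracPochInv m * (1 - algebraMap ℤ⟦X⟧ _ PowerSeries.X ^ m) = fracPochInv (m - 1) := by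
  rcases lt_trichotomy m 0 with h | rfl | h
  · rw [fracPochInv, fracPochInv, if_neg (by omega), if_neg (by omega), zero_mul]
  · rw [zpow_zero, sub_self, mul_zero, fracPochInv, if_neg (by norm_num)]
  · obtain ⟨n, rfl⟩ : ∃ n : ℕ, m = (n + 1 : ℕ) := ⟨(m - 1).toNat, by omega⟩
    rw [fracPochInv, fracPochInv, if_pos (by omega), if_pos (by omega), zpow_natCast,
      show ((n + 1 : ℕ) - 1 : ℤ).toNat = n by omega, Int.toNat_natCast, ← qPochInv_succ_mul n]
    simp

theorem algebraMap_X_ne_zero : algebraMap ℤ⟦X⟧ (FractionRing ℤ⟦X⟧) PowerSeries.X ≠ 0 :=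
  (map_ne_zero_iff _ (IsFractionRing.injective _ _)).2 PowerSeries.X_ne_zero

theorem algebraMap_X_pow_ne_one {n : ℕ} (hn : n ≠ 0) :
    algebraMap ℤ⟦X⟧ (FractionRing ℤ⟦X⟧) PowerSeries.X ^ n ≠ 1 := by
  rw [← map_pow, ← map_one (algebraMap ℤ⟦X⟧ (FractionRing ℤ⟦X⟧))]
  intro h
  have h1 := congrArg PowerSeries.constantCoeff (IsFractionRing.injective ℤ⟦X⟧ _ h)
  simp [hn] at h1

/-- In the fraction field both sides solve the recursion of `recursion_unique`. They are compared at
(s, t) = (0, k), where each carries a factor q^n, which is then cancelled. -/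
theorem configSeries_eq (k n : ℕ) :
    configSeries k n k k = ∑ᶠ m ∈ {m : Fin k → ℕ | partitionSize m = n},
      (PowerSeries.X : ℤ⟦X⟧) ^ Q k m * ∏ l, qPochInv (m l) := by
  set ι := algebraMap ℤ⟦X⟧ (FractionRing ℤ⟦X⟧) with hι
  have hinj : Function.Injective ι := IsFractionRing.injective _ _
  have hq : ι PowerSeries.X ≠ 0 := algebraMap_X_ne_zero
  have hneg : ∀ m < 0, fracPochInv m = 0 := fun m hm => if_neg (by omega)
  have hb : ∀ n : ℕ, bracket (ι PowerSeries.X) fracPochInv k n (fun _ => 1) =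
      ι (∑ᶠ m ∈ {m : Fin k → ℕ | partitionSize m = n},
        (PowerSeries.X : ℤ⟦X⟧) ^ Q k m * ∏ l, qPochInv (m l)) := by
    intro n
    have h := AddMonoidHom.map_finsum_mem
      (fun m : Fin k → ℕ => (PowerSeries.X : ℤ⟦X⟧) ^ Q k m * ∏ l, qPochInv (m l))
      (ι : ℤ⟦X⟧ →+ FractionRing ℤ⟦X⟧) (finite_partitionSize k n)
    rw [bracket_one hq hneg]
    refine Eq.trans (finsum_mem_congr rfl fun m _ => ?_) h.symm
    simp [fracPochInv, hι]
  have hX : ∀ n t, t ≤ k → sumBracket (ι PowerSeries.X) fracPochInv k (n : ℕ) 0 t =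
      ι PowerSeries.X ^ n * sumBracket (ι PowerSeries.X) fracPochInv k (n : ℕ) t k := by
    intro n t ht
    rw [sumBracket_zero hq fracPochInv_mul hneg ht, zpow_natCast]
  have h0 : bracket (ι PowerSeries.X) fracPochInv k (0 : ℕ) (fun _ => 1) = 1 := by
    have : {m : Fin k → ℕ | partitionSize m = 0} = {0} := by
      ext m
      simp [partitionSize, funext_iff]
    rw [hb, this, finsum_mem_singleton]
    have hQ : Q k 0 = 0 := by simp [Q]
    have hP : qPochInv 0 = 1 := by simpa [qPoch] using qPoch_mul_qPochInv 0
    simp [hQ, hP]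
  have key := recursion_unique (q := ι PowerSeries.X) (k := k)
    (fun n hn => algebraMap_X_pow_ne_one hn)
    (X := fun n s t => sumBracket (ι PowerSeries.X) fracPochInv k n s t)
    (Y := fun n s t => ι (configSeries k n s t))
    (by
      simp only [configSeries_zero_zero, map_one]
      rw [sumBracket_zero_top hq hneg, h0]
      simp)
    hX (fun n t _ => by simp only [configSeries_zero, map_mul, map_pow])
    (fun n s t hs ht => by
      rw [sumBracket_succ hq fracPochInv_mul hneg hs ht]
      congr 1
      split_ifs with h
      · rw [← Nat.cast_sub h, zpow_natCast]
      · rw [sumBracket_of_neg hq hneg _ (by omega), mul_zero])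
    (fun n s t hs ht => by
      rw [configSeries_succ n hs ht, map_add]
      congr 1
      split_ifs with h
      · simp
      · simp)
  have h1 := key n 0 k (Nat.zero_le k) le_rfl
  simp only [sumBracket_zero_top hq hneg, configSeries_zero, map_mul, map_pow, zpow_natCast] at h1
  rw [hb] at h1
  exact hinj (mul_left_cancel₀ (pow_ne_zero n hq) h1).symm

/-! ### Summability, and summation over the number of particles. -/

theorem le_of_Q_le {k d : ℕ} {m : Fin k → ℕ} (h : Q k m ≤ d) (l : Fin k) : m l ≤ d + 1 := by
  -- Dropping the off-diagonal entries and using `A_{ii} ≥ 2` bounds Q below by m_l(m_l - 1), which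
  -- exceeds d once m_l ≥ d + 2.
  have hterm : ∀ i : Fin k, 2 * ((m i : ℤ) * (m i - 1)) ≤
      (((A k).mulVec m i * m i : ℕ) : ℤ) - (A k i i * m i : ℕ) := by
    intro i
    have h1 : A k i i * m i ≤ (A k).mulVec m i :=
      Finset.single_le_sum (f := fun j => A k i j * m j) (fun _ _ => Nat.zero_le _)
        (Finset.mem_univ i)
    have h2 : 2 ≤ A k i i := by
      simp only [A, Matrix.of_apply, min_self]
      omega
    have h3 : (0 : ℤ) ≤ (m i : ℤ) * (m i - 1) := by
      rcases Nat.eq_zero_or_pos (m i) with h | h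
      · simp [h]
      · exact mul_nonneg (by omega) (by omega)
    have h4 : ((A k i i * m i * m i : ℕ) : ℤ) ≤ ((A k).mulVec m i * m i : ℕ) := by
      exact_mod_cast Nat.mul_le_mul_right _ h1
    have h5 : (2 : ℤ) ≤ A k i i := by exact_mod_cast h2
    have h6 := mul_le_mul_of_nonneg_right h5 h3
    push_cast at h4 ⊢
    linarith
  have hsum : 2 * ((m l : ℤ) * (m l - 1)) ≤ 2 * Q k m := by
    rw [two_mul_Q, dotProduct, Nat.cast_sum, Nat.cast_sum, ← Finset.sum_sub_distrib]
    refine (hterm l).trans (Finset.single_le_sum (f := fun i => (((A k).mulVec m i * m i : ℕ) : ℤ) -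
      (A k i i * m i : ℕ)) (fun i _ => le_trans ?_ (hterm i)) (Finset.mem_univ l))
    rcases Nat.eq_zero_or_pos (m i) with h | h
    · simp [h]
    · exact mul_nonneg (by norm_num) (mul_nonneg (by omega) (by omega))
  by_contra hlt
  have h1 : (d : ℤ) + 2 ≤ m l := by omega
  have h2 : (Q k m : ℤ) ≤ d := by exact_mod_cast h
  nlinarith

theorem finite_Q_le (k d : ℕ) : {m : Fin k → ℕ | Q k m ≤ d}.Finite :=
  (Set.Finite.pi fun _ : Fin k => Set.finite_Iic (d + 1)).subset fun _ hm l _ => le_of_Q_le hm l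

theorem boundedConfigs_top (k n d : ℕ) :
    boundedConfigs k n k k d = {a | a ∈ configurations k ∧ size a = n ∧ degree a = d} := by
  ext a
  constructor
  · rintro ⟨h1, h2, h3, -, -⟩
    exact ⟨h1, h2, h3⟩
  · rintro ⟨h1, h2, h3⟩
    have := h1 0
    rw [zero_add] at this
    exact ⟨h1, h2, h3, by omega, by omega⟩

/-- At most k particles sit at position 0, and every other particle adds at least 1 to the degree.
-/
theorem size_le {k : ℕ} {a : ℕ →₀ ℕ} (ha : a ∈ configurations k) : size a ≤ k + degree a := by
  obtain ⟨b, hb⟩ := exists_eq_prepend a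
  have := ha 0
  rw [hb, size_prepend, degree_prepend]
  omega

theorem finite_configurations_degree (k d : ℕ) :
    {a | a ∈ configurations k ∧ degree a = d}.Finite := by
  refine ((Set.finite_Iic (k + d)).biUnion fun n _ => finite_boundedConfigs k n k k d).subset ?_
  rintro a ⟨h1, rfl⟩
  rw [Set.mem_iUnion₂]
  exact ⟨size a, size_le h1, by rw [boundedConfigs_top]; exact ⟨h1, rfl, rfl⟩⟩

theorem tsum_fiber_configurations (k d n : ℕ) :
    ∑' a : size ⁻¹' {n}, (configurations k).indicator
      (fun a => PowerSeries.coeff d ((PowerSeries.X : ℤ⟦X⟧) ^ degree a)) a =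
    PowerSeries.coeff d (configSeries k n k k) := by
  rw [configSeries, PowerSeries.coeff_mk, tsum_subtype (size ⁻¹' {n}) ((configurations k).indicator
    (fun a => PowerSeries.coeff d ((PowerSeries.X : ℤ⟦X⟧) ^ degree a)))]
  have hfin := finite_boundedConfigs k n k k d
  have : (size ⁻¹' {n}).indicator ((configurations k).indicator
      (fun a => PowerSeries.coeff d ((PowerSeries.X : ℤ⟦X⟧) ^ degree a))) =
      (hfin.toFinset : Set (ℕ →₀ ℕ)).indicator fun _ => (1 : ℤ) := by
    classical
    rw [Set.Finite.coe_toFinset, boundedConfigs_top]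
    ext a
    simp only [Set.indicator_apply, PowerSeries.coeff_X_pow, Set.mem_preimage,
      Set.mem_singleton_iff, Set.mem_ofPred_eq, ← ite_and]
    refine if_congr ?_ rfl rfl
    tauto
  rw [this, ← tsum_subtype, Finset.tsum_subtype' hfin.toFinset fun _ => (1 : ℤ)]
  rw [Set.ncard_eq_toFinset_card _ hfin]
  simp

theorem tsum_fiber_partitions (k d n : ℕ) :
    ∑' m : (partitionSize (k := k)) ⁻¹' {n},
      PowerSeries.coeff d ((PowerSeries.X : ℤ⟦X⟧) ^ Q k m * ∏ l, qPochInv (m.1 l)) =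
    PowerSeries.coeff d (configSeries k n k k) := by
  have hfin : ((partitionSize (k := k)) ⁻¹' {n}).Finite := finite_partitionSize k n
  have := hfin.to_subtype
  rw [configSeries_eq, tsum_eq_finsum (Set.toFinite _)]
  have h := AddMonoidHom.map_finsum_mem
      (fun m : Fin k → ℕ => (PowerSeries.X : ℤ⟦X⟧) ^ Q k m * ∏ l, qPochInv (m l))
      (PowerSeries.coeff (R := ℤ) d).toAddMonoidHom hfin
  refine Eq.trans ?_ h.symm
  exact finsum_set_coe_eq_finsum_mem (f := fun m : Fin k → ℕ =>
    PowerSeries.coeff d ((PowerSeries.X : ℤ⟦X⟧) ^ Q k m * ∏ l, qPochInv (m l))) _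

end Identity

end FermionicFormula

/-- The identity `∑_a q^{d(a)} = ∑_{m_1,…,m_k ≥ 0} q^{Q(m)} / ∏_l (q)_{m_l}` in `ℤ⟦q⟧`.
With `ℤ` discrete and the product topology on `ℤ⟦q⟧`, a family is summable exactly when each
power of `q` has a non-zero coefficient in only finitely many members. -/
theorem mainTheorem5 (k : ℕ) :
    Summable (fun a : FermionicFormula.configurations k =>
      (PowerSeries.X : ℤ⟦X⟧) ^ FermionicFormula.degree (a : ℕ →₀ ℕ)) ∧
    Summable (fun m : Fin k → ℕ =>
      (PowerSeries.X : ℤ⟦X⟧) ^ FermionicFormula.Q k m *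
        ∏ l, FermionicFormula.qPochInv (m l)) ∧
    ∑' a : FermionicFormula.configurations k,
        (PowerSeries.X : ℤ⟦X⟧) ^ FermionicFormula.degree (a : ℕ →₀ ℕ) =
      ∑' m : Fin k → ℕ,
        (PowerSeries.X : ℤ⟦X⟧) ^ FermionicFormula.Q k m *
          ∏ l, FermionicFormula.qPochInv (m l) := by
  have s1 : ∀ d, Summable ((FermionicFormula.configurations k).indicator fun a =>
      PowerSeries.coeff d ((PowerSeries.X : ℤ⟦X⟧) ^ FermionicFormula.degree a)) := fun d => by
    refine summable_of_hasFiniteSupport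
      ((FermionicFormula.finite_configurations_degree k d).subset fun a ha => ?_)
    rw [Function.mem_support, Set.indicator_apply_ne_zero] at ha
    refine ⟨ha.1, ?_⟩
    by_contra hne
    exact ha.2 ((PowerSeries.coeff_X_pow _ _).trans (if_neg (Ne.symm hne)))
  have s2 : ∀ d, Summable fun m : Fin k → ℕ =>
      PowerSeries.coeff d ((PowerSeries.X : ℤ⟦X⟧) ^ FermionicFormula.Q k m *
        ∏ l, FermionicFormula.qPochInv (m l)) := fun d => by
    refine summable_of_hasFiniteSupport
      ((FermionicFormula.finite_Q_le k d).subset fun m hm => ?_)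
    by_contra hne
    exact hm ((PowerSeries.coeff_X_pow_mul' _ _ _).trans (if_neg hne))
  have S1 : Summable (fun a : FermionicFormula.configurations k =>
      (PowerSeries.X : ℤ⟦X⟧) ^ FermionicFormula.degree (a : ℕ →₀ ℕ)) :=
    (PowerSeries.WithPiTopology.summable_iff_summable_coeff ℤ).2 fun d =>
      summable_subtype_iff_indicator.2 (s1 d)
  have S2 : Summable (fun m : Fin k → ℕ =>
      (PowerSeries.X : ℤ⟦X⟧) ^ FermionicFormula.Q k m *
        ∏ l, FermionicFormula.qPochInv (m l)) :=
    (PowerSeries.WithPiTopology.summable_iff_summable_coeff ℤ).2 s2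
  refine ⟨S1, S2, ?_⟩
  ext d
  have t1 := ((PowerSeries.WithPiTopology.hasSum_iff_hasSum_coeff ℤ).1 S1.hasSum d).tsum_eq
  have t2 := ((PowerSeries.WithPiTopology.hasSum_iff_hasSum_coeff ℤ).1 S2.hasSum d).tsum_eq
  -- Coefficientwise, both sums are regrouped by n, that is by `size` and by `partitionSize`, and
  -- the fibres then agree.
  have u1 := ((s1 d).hasSum.tsum_fiberwise FermionicFormula.size).tsum_eq
  have u2 := ((s2 d).hasSum.tsum_fiberwise FermionicFormula.partitionSize).tsum_eq
  simp only [FermionicFormula.tsum_fiber_configurations] at u1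
  simp only [FermionicFormula.tsum_fiber_partitions] at u2
  rw [← t1, ← t2, ← u2, u1]
  exact tsum_subtype _ fun a =>
    PowerSeries.coeff d ((PowerSeries.X : ℤ⟦X⟧) ^ FermionicFormula.degree a)
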